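/- Notation. Let $q$ be a prime power. For a linear code $\mathcal C\subseteq\mathbb F_{q^2}^n$ let $d(\mathcal C)$ be its minimum Hamming distance and $\mathcal C^{\perp_{\mathrm H}}=\{x\in\mathbb F_{q^2}^n:\sum_{i} x_i y_i^q=0\text{ for all }y\in\mathcal C\}$ its Hermitian dual. $\mathcal C$ is an $(r,\delta)$-LRC if every coordinate $i$ lies in a set $S_i\subseteq\{1,\dots,n\}$ with $|S_i|\le r+\delta-1$ such that the punctured code $\mathcal C|_{S_i}$ (keep only the coordinates in $S_i$) has minimum distance at least $\delta$. A quantum code with parameters $[[n,k,d]]_q$ is a $q^k$-dimensional subspace of $(\mathbb C^q)^{\otimes n}$ with minimum distance $d$, i.e. $d$ is the least weight of an error operator that it does not detect. An optimal quantum $(r,\delta)$-LRC with parameters $[[n,k,d]]_q$ is a quantum code with parameters $[[n,k,d]]_q$ that is the stabilizer code induced, by the Hermitian construction, by a linear code $\mathcal C\subseteq\mathbb F_{q^2}^n$ such that $\mathcal C^{\perp_{\mathrm H}}\subseteq\mathcal C$, $\dim\mathcal C=\frac{n+k}{2}$, $d(\mathcal C)=d$, $\mathcal C$ is an $(r,\delta)$-LRC,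 $\delta\le d(\mathcal C^{\perp_{\mathrm H}})$, and $$k+2d+2\Big(\Big\lceil\frac{n+k}{2r}\Big\rceil-1\Big)(\delta-1)=n+2 .$$ Theorem. Let $q\ge 8$ be a prime power and let $N$ be a positive integer with $N\mid q^2-1$ and $N\nmid q+1$. Let $s,v,t\ge 1$ and $l\ge 0$ be integers such that $v\mid q-1$, $2s+l\le v-1$, $l\le\lfloor s/2\rfloor+1$ and $Nvt\le q+v-s-l-2$. Then there exists an optimal quantum $(r,\delta)$-LRC with $(r,\delta)=(q+v-s-1,\,s+1)$ and parameters $$\big[\big[\,Nt(2q+v-2),\ Nt(2q+v-2)-4Nst-2l,\ s+l+1\,\big]\big]_q .$$ Moreover, these codes form an infinite family: the set of lengths $Nt(2q+v-2)$ arising from admissible parameters $(q,N,s,v,t,l)$ is infinite. -/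

import Mathlib

/-! ### Classical linear codes -/

/-- Hermitian dual of a code `C ⊆ Kⁿ` (with `K = F_{q²}`): all `x` with `∑ xᵢ yᵢ^q = 0` for every
`y ∈ C`. -/
def hermitianDual {K : Type*} [Field K] {n : ℕ} (q : ℕ) (C : Submodule K (Fin n → K)) :
    Submodule K (Fin n → K) where
  carrier := {x | ∀ y ∈ C, ∑ i, x i * y i ^ q = 0}
  add_mem' := by
    intro a b ha hb y hy
    simp only [Pi.add_apply, add_mul, Finset.sum_add_distrib, ha y hy, hb y hy, add_zero]
  zero_mem' := by
    intro y _
    simp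
  smul_mem' := by
    intro c a ha y hy
    simp only [Pi.smul_apply, smul_eq_mul, mul_assoc, ← Finset.mul_sum, ha y hy, mul_zero]

/-- All nonzero words of `C` have weight at least `d`, i.e. the minimum distance is at least `d`. -/
def MinDistGE {K : Type*} [Field K] [DecidableEq K] {ι : Type*} [Fintype ι]
    (C : Submodule K (ι → K)) (d : ℕ) : Prop :=
  ∀ c ∈ C, c ≠ 0 → d ≤ hammingNorm c

/-- The minimum distance of the linear code `C` is exactly `d`. -/
def HasMinDist {K : Type*} [Field K] [DecidableEq K] {ι : Type*} [Fintype ι]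
    (C : Submodule K (ι → K)) (d : ℕ) : Prop :=
  IsLeast {w : ℕ | ∃ c ∈ C, c ≠ 0 ∧ hammingNorm c = w} d

/-- The punctured code `C|_S`: keep exactly the coordinates in `S`. -/
def puncture {K : Type*} [Field K] {n : ℕ} (C : Submodule K (Fin n → K)) (S : Finset (Fin n)) :
    Submodule K (S → K) :=
  C.map (LinearMap.funLeft K K (Subtype.val : S → Fin n))

/-- `C` is an `(r, δ)`-LRC: every coordinate lies in a set `S` with `|S| ≤ r + δ - 1` such that the
punctured code `C|_S` has minimum distance at least `δ`. -/
def IsLRC {K : Type*} [Field K] [DecidableEq K] {n : ℕ} (C : Submodule K (Fin n → K))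
    (r δ : ℕ) : Prop :=
  ∀ i : Fin n, ∃ S : Finset (Fin n), i ∈ S ∧ S.card ≤ r + δ - 1 ∧ MinDistGE (puncture C S) δ

/-! ### Quantum codes -/

/-- The Hilbert space `(ℂ^q)^{⊗ n} ≅ ℂ^{q^n}` of `n` qudits, with orthonormal basis indexed by
`F^n`, where `F = F_q`. -/
abbrev QuditSpace (F : Type*) [Fintype F] (n : ℕ) : Type _ :=
  EuclideanSpace ℂ (Fin n → F)

/-- The error operator `X(a) Z(b)`, where `u = (a, b)`: `X(a) |x⟩ = |x + a⟩` and
`Z(b) |x⟩ = χ(b ⬝ x) |x⟩`. -/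
def errorOp {F : Type*} [Field F] [Fintype F] {n : ℕ} (χ : AddChar F ℂ)
    (u : (Fin n → F) × (Fin n → F)) : QuditSpace F n →ₗ[ℂ] QuditSpace F n where
  toFun ψ := WithLp.toLp 2 fun x => χ (∑ i, u.2 i * (x i - u.1 i)) * ψ (x - u.1)
  map_add' := by
    intro φ ψ
    ext x
    simp [mul_add]
  map_smul' := by
    intro c ψ
    ext x
    simp [mul_left_comm]

/-- The weight of the error `X(a) Z(b)`: the number of qudits on which it acts nontrivially. -/
def errorWeight {F : Type*} [Field F] [DecidableEq F] {n : ℕ}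
    (u : (Fin n → F) × (Fin n → F)) : ℕ :=
  hammingNorm fun i => (u.1 i, u.2 i)

/-- The quantum code `Q` detects the operator `E` (with `P` the orthogonal projection onto `Q`,
`P E P = c P` for some scalar `c`). -/
def Detects {F : Type*} [Fintype F] {n : ℕ} (Q : Submodule ℂ (QuditSpace F n))
    (E : QuditSpace F n →ₗ[ℂ] QuditSpace F n) : Prop :=
  ∃ c : ℂ, ∀ φ ∈ Q, ∀ ψ ∈ Q, inner ℂ φ (E ψ) = c * inner ℂ φ ψ

/-- `Q` is a quantum code with parameters `[[n, k, d]]_q`, `q = |F|`: it has dimension `q ^ k`, and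
`d` is the smallest weight of an error that it does not detect. -/
def IsQuantumCode {F : Type*} [Field F] [Fintype F] [DecidableEq F] {n : ℕ} (χ : AddChar F ℂ)
    (Q : Submodule ℂ (QuditSpace F n)) (k d : ℕ) : Prop :=
  Module.finrank ℂ Q = Fintype.card F ^ k ∧
    IsLeast {w : ℕ | ∃ u : (Fin n → F) × (Fin n → F),
      ¬ Detects Q (errorOp χ u) ∧ errorWeight u = w} d

/-- The identification of `F_q^n × F_q^n` with `F_{q²}^n` given by a normal basis `(β, β^q)`:
`(a, b) ↦ β a + β^q b`. -/
def toExtension {F K : Type*} [Field F] [Fintype F] [Field K] [Algebra F K] {n : ℕ} (β : K)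
    (u : (Fin n → F) × (Fin n → F)) : Fin n → K :=
  fun i => u.1 i • β + u.2 i • β ^ Fintype.card F

/-- `Q` is a stabilizer code induced (by the Hermitian construction) by the code `C ⊆ F_{q²}^n`.
The stabilizer consists of the operators `ω(a,b) X(a) Z(b)`, one for each `(a, b)` corresponding to
a word of the Hermitian dual of `C`; the phases `ω` make these operators a group, and `Q` is
the space of all vectors fixed by this group. -/
def IsInducedBy {F K : Type*} [Field F] [Fintype F] [Field K] [Algebra F K] {n : ℕ}
    (χ : AddChar F ℂ) (β : K) (C : Submodule K (Fin n → K))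
    (Q : Submodule ℂ (QuditSpace F n)) : Prop :=
  ∃ ω : (Fin n → F) × (Fin n → F) → ℂ,
    (∀ u, toExtension β u ∈ hermitianDual (Fintype.card F) C → ‖ω u‖ = 1) ∧
    (∀ u u', toExtension β u ∈ hermitianDual (Fintype.card F) C →
      toExtension β u' ∈ hermitianDual (Fintype.card F) C →
      (ω u • errorOp χ u) ∘ₗ (ω u' • errorOp χ u') = ω (u + u') • errorOp χ (u + u')) ∧
    (∀ ψ, ψ ∈ Q ↔
      ∀ u, toExtension β u ∈ hermitianDual (Fintype.card F) C → (ω u • errorOp χ u) ψ = ψ)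

/-- `Q` is an optimal quantum `(r, δ)`-LRC with parameters `[[n, k, d]]_q`, `q = |F|`, induced by a
Hermitian dual-containing code over `K = F_{q²}`. -/
def IsOptimalQuantumLRC {F K : Type*} [Field F] [Fintype F] [DecidableEq F] [Field K]
    [DecidableEq K] [Algebra F K] {n : ℕ} (χ : AddChar F ℂ) (β : K)
    (Q : Submodule ℂ (QuditSpace F n)) (k d r δ : ℕ) : Prop :=
  0 < r ∧ 1 < δ ∧ IsQuantumCode χ Q k d ∧
  ∃ C : Submodule K (Fin n → K),
    IsInducedBy χ β C Q ∧
    hermitianDual (Fintype.card F) C ≤ C ∧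
    2 * Module.finrank K C = n + k ∧
    HasMinDist C d ∧
    IsLRC C r δ ∧
    MinDistGE (hermitianDual (Fintype.card F) C) δ ∧
    (k : ℤ) + 2 * d + 2 * (⌈((n : ℚ) + k) / (2 * r)⌉ - 1) * ((δ : ℤ) - 1) = n + 2

/-! ### The admissible parameters -/

/-- The conditions on the parameters of the family. -/
structure AdmissibleParams (q N s v t l : ℕ) : Prop where
  isPrimePow : IsPrimePow q
  eight_le : 8 ≤ q
  N_dvd : N ∣ q ^ 2 - 1
  N_not_dvd : ¬ N ∣ q + 1
  s_pos : 0 < s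
  v_pos : 0 < v
  t_pos : 0 < t
  v_dvd : v ∣ q - 1
  two_s_add_l_le : 2 * s + l ≤ v - 1
  l_le : l ≤ s / 2 + 1
  N_mul_v_mul_t_le : ((N * v * t : ℕ) : ℤ) ≤ (q : ℤ) + v - s - l - 2

/-! The classical code is the Hermitian dual of a code `D` of checks. Take `N * t` pairs of blocks:
a small one evaluated at `Fˣ`, and a large one at `Fˣ` together with the coset `β⟨ζ⟩` of the
subgroup of order `v`. `D` is spanned by the powers `x, ..., x ^ s` on each block and by `l` global
rows `γ * x ^ (s + 1), ..., γ * x ^ (s + l)`.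

Self-orthogonality of `D` (`checkCode_le_hermitianDual`) has two sources. If a local row is
involved, the exponents sum to at most `2 * s + l < v`, so the power sums over `Fˣ` and over `⟨ζ⟩`
vanish. For two global rows the sum may be too large; there `γ` runs through the powers of an
element of order `N`, and `∑ γ ^ (q + 1) = 0` because `N ∤ q + 1`.

Distances come from Vandermonde arguments. A word of the dual that meets a block has at least `s +
1` nonzero entries there; two blocks give `2 * s + 2`, and a single block sees all `s + l`
consecutive powers. So the distance is `s + l + 1`, and it is attained. Words of `D` are heavier, so
the stabilizer code has this distance too (`exists_isQuantumCode_isInducedBy`). The bound on `N * v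
* t` makes the ceiling equal to `2 * N * t`, which gives optimality. -/

/-- In a minimal nonzero subspace stable under all `f i`, an eigenspace of one `f i` cuts out a
stable nonzero subspace by commutativity, hence everything. -/
theorem Module.End.exists_common_eigenvector {k V ι : Type*} [Field k] [IsAlgClosed k]
    [AddCommGroup V] [Module k V] [FiniteDimensional k V] [Nontrivial V]
    (f : ι → Module.End k V) (hf : ∀ i j, Commute (f i) (f j)) :
    ∃ v : V, v ≠ 0 ∧ ∀ i, ∃ μ : k, f i v = μ • v := by
  let P : Set (Submodule k V) := {W | W ≠ ⊥ ∧ ∀ i, ∀ w ∈ W, f i w ∈ W}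
  have hP : P.Nonempty := ⟨⊤, top_ne_bot, fun _ _ _ => trivial⟩
  obtain ⟨W, ⟨hW0, hW⟩, hmin⟩ := WellFounded.has_min (wellFounded_lt (α := Submodule k V)) P hP
  obtain ⟨w, hw, hw0⟩ := Submodule.exists_mem_ne_zero_of_ne_bot hW0
  refine ⟨w, hw0, fun i => ?_⟩
  have : Nontrivial W := Submodule.nontrivial_iff_ne_bot.2 hW0
  obtain ⟨μ, hμ⟩ := Module.End.exists_eigenvalue ((f i).restrict (hW i))
  obtain ⟨e, he⟩ := hμ.exists_hasEigenvector
  have hmem : W ⊓ Module.End.eigenspace (f i) μ ∈ P := by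
    constructor
    · rw [Submodule.ne_bot_iff]
      refine ⟨e, ⟨e.2, ?_⟩, fun h => he.2 (Subtype.ext h)⟩
      have := congrArg Subtype.val he.apply_eq_smul
      exact Module.End.mem_eigenspace_iff.2 (by simpa using this)
    · rintro j x ⟨hx, hx'⟩
      refine ⟨hW j x hx, ?_⟩
      rw [SetLike.mem_coe, Module.End.mem_eigenspace_iff] at hx' ⊢
      have := LinearMap.congr_fun (hf i j).eq x
      simp only [Module.End.mul_apply] at this
      rw [this, hx', map_smul]
  have hle : W ⊓ Module.End.eigenspace (f i) μ = W := by
    by_contra hne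
    exact hmin _ hmem (lt_of_le_of_ne inf_le_left hne)
  exact ⟨μ, Module.End.mem_eigenspace_iff.1 ((inf_eq_left.1 hle) hw)⟩

/-! ### Algebra and traces of the error operators. -/

section ErrorOperators

variable {F : Type*} [Field F] [Fintype F] {n : ℕ} (χ : AddChar F ℂ)

theorem errorOp_apply (u : (Fin n → F) × (Fin n → F)) (ψ : QuditSpace F n) (x : Fin n → F) :
    errorOp χ u ψ x = χ (∑ i, u.2 i * (x i - u.1 i)) * ψ (x - u.1) := rfl

theorem errorOp_mul (u w : (Fin n → F) × (Fin n → F)) (ψ : QuditSpace F n) :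
    errorOp χ u (errorOp χ w ψ) = χ (∑ i, u.2 i * w.1 i) • errorOp χ (u + w) ψ := by
  ext x
  rw [errorOp_apply, errorOp_apply, PiLp.smul_apply, errorOp_apply, smul_eq_mul, ← mul_assoc,
    ← mul_assoc, ← AddChar.map_add_eq_mul, ← AddChar.map_add_eq_mul, ← Finset.sum_add_distrib,
    ← Finset.sum_add_distrib, Prod.fst_add, sub_sub]
  congr 2
  refine Finset.sum_congr rfl fun i _ => ?_
  simp only [Pi.sub_apply, Pi.add_apply, Prod.snd_add]
  ring

theorem errorOp_zero : errorOp χ (0 : (Fin n → F) × (Fin n → F)) = LinearMap.id := by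
  ext ψ x
  simp [errorOp_apply]

theorem errorOp_comm (u w : (Fin n → F) × (Fin n → F)) (ψ : QuditSpace F n) :
    errorOp χ u (errorOp χ w ψ) =
      χ (∑ i, (u.2 i * w.1 i - w.2 i * u.1 i)) • errorOp χ w (errorOp χ u ψ) := by
  rw [errorOp_mul, errorOp_mul, smul_smul, ← AddChar.map_add_eq_mul, ← Finset.sum_add_distrib,
    add_comm w u]
  simp

theorem errorOp_inner (u : (Fin n → F) × (Fin n → F)) (φ ψ : QuditSpace F n) :
    inner ℂ (errorOp χ u φ) (errorOp χ u ψ) = inner ℂ φ ψ := by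
  rw [PiLp.inner_apply, PiLp.inner_apply]
  refine Fintype.sum_equiv (Equiv.subRight u.1) _ _ fun x => ?_
  rw [errorOp_apply, errorOp_apply]
  simp only [RCLike.inner_apply, map_mul, Equiv.subRight_apply]
  have h := RCLike.mul_conj (χ (∑ i, u.2 i * (x i - u.1 i)))
  rw [AddChar.norm_apply, RCLike.ofReal_one, one_pow] at h
  linear_combination (ψ (x - u.1) * (starRingEnd ℂ) (φ (x - u.1))) * h

theorem sum_addChar_dotProduct {χ : AddChar F ℂ} (hχ : χ ≠ 1) {b : Fin n → F} (hb : b ≠ 0) :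
    ∑ x : Fin n → F, χ (∑ i, b i * x i) = 0 := by
  classical
  obtain ⟨j, hj⟩ := Function.ne_iff.1 hb
  obtain ⟨a, ha⟩ := (AddChar.ne_one_iff).1 hχ
  have key : ∑ x : Fin n → F, χ (∑ i, b i * x i)
      = χ a * ∑ x : Fin n → F, χ (∑ i, b i * x i) := by
    -- This translation raises `b ⬝ x` by exactly `a`, so it multiplies the sum by `χ a ≠ 1`.
    rw [Finset.mul_sum, ← Equiv.sum_comp (Equiv.addLeft (Pi.single j ((b j)⁻¹ * a)))]
    refine Finset.sum_congr rfl fun x _ => ?_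
    rw [← AddChar.map_add_eq_mul]
    congr 1
    simp only [Equiv.coe_addLeft, Pi.add_apply, mul_add, Finset.sum_add_distrib]
    congr 1
    rw [Finset.sum_eq_single j]
    · rw [Pi.single_eq_same, mul_inv_cancel_left₀ hj]
    · intro i _ hi
      rw [Pi.single_eq_of_ne hi, mul_zero]
    · simp
  have : (χ a - 1) * ∑ x : Fin n → F, χ (∑ i, b i * x i) = 0 := by
    rw [sub_mul, ← key]; ring
  exact (mul_eq_zero.1 this).resolve_left (sub_ne_zero.2 ha)

/-- A nonzero shift has no diagonal entries; without a shift the trace is a nontrivial character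
sum. -/
theorem trace_errorOp {χ : AddChar F ℂ} (hχ : χ ≠ 1) {u : (Fin n → F) × (Fin n → F)}
    (hu : u ≠ 0) : LinearMap.trace ℂ (QuditSpace F n) (errorOp χ u) = 0 := by
  classical
  rw [LinearMap.trace_eq_sum_inner _ (EuclideanSpace.basisFun (Fin n → F) ℂ)]
  simp only [EuclideanSpace.basisFun_apply, EuclideanSpace.inner_single_left, errorOp_apply,
    PiLp.single_apply, map_one, one_mul]
  by_cases ha : u.1 = 0
  · have hb : u.2 ≠ 0 := fun hb => hu (Prod.ext ha hb)
    simpa [ha] using sum_addChar_dotProduct hχ hb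
  · refine Finset.sum_eq_zero fun x _ => ?_
    rw [if_neg, mul_zero]
    simpa using ha

theorem trace_errorOp_zero :
    LinearMap.trace ℂ (QuditSpace F n) (errorOp χ 0) = (Fintype.card F : ℂ) ^ n := by
  rw [errorOp_zero, LinearMap.trace_id]
  simp

end ErrorOperators

/-! ### Stabilizer codes: dimension and detected errors. -/

section Stabilizer

variable {F : Type*} [Field F] [Fintype F] {n : ℕ} {χ : AddChar F ℂ}

/-- The commuting operators have a common eigenvector. Dividing each one by its eigenvalue there
makes the vector fixed by all, which forces the multiplication cocycle to become trivial. -/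
theorem exists_stabilizer_phases (S : AddSubgroup ((Fin n → F) × (Fin n → F)))
    (hS : ∀ u ∈ S, ∀ w ∈ S, χ (∑ i, (u.2 i * w.1 i - w.2 i * u.1 i)) = 1) :
    ∃ ω : (Fin n → F) × (Fin n → F) → ℂ, (∀ u ∈ S, ‖ω u‖ = 1) ∧
      ∀ u ∈ S, ∀ w ∈ S,
        (ω u • errorOp χ u) ∘ₗ (ω w • errorOp χ w) = ω (u + w) • errorOp χ (u + w) := by
  classical
  obtain ⟨ψ, hψ0, hψ⟩ := Module.End.exists_common_eigenvector
    (fun u : S => (errorOp χ (u : (Fin n → F) × (Fin n → F)) : Module.End ℂ (QuditSpace F n)))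
    (fun u w => LinearMap.ext fun φ => by
      rw [Module.End.mul_apply, Module.End.mul_apply, errorOp_comm, hS _ u.2 _ w.2, one_smul])
  choose μ hμ using hψ
  have hnorm : ∀ u, ‖μ u‖ = 1 := by
    intro u
    have h := errorOp_inner χ (u : (Fin n → F) × (Fin n → F)) ψ ψ
    rw [hμ u, inner_smul_left, inner_smul_right, ← mul_assoc] at h
    have h1 : (starRingEnd ℂ) (μ u) * μ u = 1 :=
      mul_right_cancel₀ (inner_self_ne_zero.2 hψ0) (h.trans (one_mul _).symm)
    have h2 := congrArg norm h1
    rw [norm_mul, RCLike.norm_conj, norm_one, ← sq] at h2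
    exact (pow_eq_one_iff_of_nonneg (norm_nonneg _) two_ne_zero).1 h2
  have hne : ∀ u, μ u ≠ 0 := fun u h => by simpa [h] using hnorm u
  refine ⟨fun u => if h : u ∈ S then (μ ⟨u, h⟩)⁻¹ else 0, ?_, ?_⟩
  · intro u hu
    simp [hu, hnorm]
  · intro u hu w hw
    have huw := S.add_mem hu hw
    simp only [hu, hw, huw, dif_pos]
    have key : μ ⟨w, hw⟩ * μ ⟨u, hu⟩ = χ (∑ i, u.2 i * w.1 i) * μ ⟨u + w, huw⟩ := by
      have h := errorOp_mul χ u w ψ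
      have e1 := hμ ⟨u, hu⟩
      have e2 := hμ ⟨w, hw⟩
      have e3 := hμ ⟨u + w, huw⟩
      simp only at e1 e2 e3
      rw [e2, e3, map_smul, e1, smul_smul, smul_smul] at h
      exact smul_left_injective ℂ hψ0 h
    refine LinearMap.ext fun φ => ?_
    simp only [LinearMap.comp_apply, LinearMap.smul_apply, map_smul, errorOp_mul, smul_smul]
    congr 1
    have h1 := hne ⟨u, hu⟩
    have h2 := hne ⟨w, hw⟩
    have h3 := hne ⟨u + w, huw⟩
    field_simp
    linear_combination -key

/-- The vectors fixed by all `ω u • errorOp χ u`, `u ∈ S`. -/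
def stabilizedSpace (χ : AddChar F ℂ) (S : AddSubgroup ((Fin n → F) × (Fin n → F)))
    (ω : (Fin n → F) × (Fin n → F) → ℂ) : Submodule ℂ (QuditSpace F n) where
  carrier := {ψ | ∀ u ∈ S, (ω u • errorOp χ u) ψ = ψ}
  add_mem' := by
    intro φ ψ hφ hψ u hu
    rw [map_add, hφ u hu, hψ u hu]
  zero_mem' := fun u _ => map_zero _
  smul_mem' := by
    intro c ψ hψ u hu
    rw [map_smul, hψ u hu]

open Classical in
/-- The average of the stabilizer operators. -/
noncomputable def stabilizerProjector (χ : AddChar F ℂ)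
    (S : AddSubgroup ((Fin n → F) × (Fin n → F)))
    (ω : (Fin n → F) × (Fin n → F) → ℂ) : QuditSpace F n →ₗ[ℂ] QuditSpace F n :=
  (Fintype.card S : ℂ)⁻¹ • ∑ u : S, ω u • errorOp χ (u : (Fin n → F) × (Fin n → F))

variable {S : AddSubgroup ((Fin n → F) × (Fin n → F))} {ω : (Fin n → F) × (Fin n → F) → ℂ}

theorem stabilizerProjector_isProj
    (hmul : ∀ u ∈ S, ∀ w ∈ S,
      (ω u • errorOp χ u) ∘ₗ (ω w • errorOp χ w) = ω (u + w) • errorOp χ (u + w)) :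
    LinearMap.IsProj (stabilizedSpace χ S ω) (stabilizerProjector χ S ω) := by
  classical
  constructor
  · intro ψ w hw
    have happ : stabilizerProjector χ S ω ψ = (Fintype.card S : ℂ)⁻¹ •
        ∑ u : S, (ω u • errorOp χ (u : (Fin n → F) × (Fin n → F))) ψ := by
      rw [stabilizerProjector, LinearMap.smul_apply, LinearMap.sum_apply]
    rw [happ, map_smul, map_sum,
      ← Equiv.sum_comp (Equiv.addLeft (⟨w, hw⟩ : S))
        (fun u : S => (ω u • errorOp χ (u : (Fin n → F) × (Fin n → F))) ψ)]
    congr 1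
    refine Finset.sum_congr rfl fun u _ => ?_
    rw [← LinearMap.comp_apply, hmul w hw u u.2]
    rfl
  · intro ψ hψ
    rw [stabilizerProjector, LinearMap.smul_apply, LinearMap.sum_apply,
      Finset.sum_congr rfl (fun u _ => hψ u.1 u.2), Finset.sum_const, Finset.card_univ,
      ← Nat.cast_smul_eq_nsmul ℂ, smul_smul, inv_mul_cancel₀, one_smul]
    exact Nat.cast_ne_zero.2 Fintype.card_ne_zero

theorem stabilizer_phase_zero
    (hnorm : ∀ u ∈ S, ‖ω u‖ = 1)
    (hmul : ∀ u ∈ S, ∀ w ∈ S,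
      (ω u • errorOp χ u) ∘ₗ (ω w • errorOp χ w) = ω (u + w) • errorOp χ (u + w)) : ω 0 = 1 := by
  classical
  have h := hmul 0 S.zero_mem 0 S.zero_mem
  rw [errorOp_zero] at h
  simp only [add_zero, errorOp_zero] at h
  have h0 : ω 0 ≠ 0 := fun h0 => by simpa [h0] using hnorm 0 S.zero_mem
  have h1 := congrArg (fun T => T (EuclideanSpace.single (0 : Fin n → F) (1 : ℂ)) 0) h
  simp only [LinearMap.comp_apply, LinearMap.smul_apply, LinearMap.id_apply, PiLp.smul_apply,
    PiLp.single_apply, if_true, smul_eq_mul, mul_one] at h1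
  exact mul_left_cancel₀ h0 (h1.trans (mul_one _).symm)

/-- The dimension is the trace of the averaging projector, to which only the identity contributes.
-/
theorem card_mul_finrank_stabilizedSpace
    (hnorm : ∀ u ∈ S, ‖ω u‖ = 1)
    (hmul : ∀ u ∈ S, ∀ w ∈ S,
      (ω u • errorOp χ u) ∘ₗ (ω w • errorOp χ w) = ω (u + w) • errorOp χ (u + w))
    (hχ : χ ≠ 1) :
    Nat.card S * Module.finrank ℂ (stabilizedSpace χ S ω) = Fintype.card F ^ n := by
  classical
  have h := (stabilizerProjector_isProj (χ := χ) hmul).trace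
  rw [stabilizerProjector, map_smul, map_sum, Finset.sum_eq_single (0 : S)] at h
  · rw [map_smul, ZeroMemClass.coe_zero, trace_errorOp_zero,
      stabilizer_phase_zero hnorm hmul, one_smul, smul_eq_mul,
      inv_mul_eq_iff_eq_mul₀ (Nat.cast_ne_zero.2 Fintype.card_ne_zero)] at h
    rw [Nat.card_eq_fintype_card]
    exact_mod_cast h.symm
  · intro u _ hu
    rw [map_smul, trace_errorOp hχ (by simpa using hu), smul_zero]
  · simp

/-- An error that does not commute with the stabilizer maps the code to its orthogonal
complement. -/
theorem detects_of_not_commute {w u : (Fin n → F) × (Fin n → F)} (hnorm : ‖ω u‖ = 1) (hu : u ∈ S)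
    (h : χ (∑ i, (u.2 i * w.1 i - w.2 i * u.1 i)) ≠ 1) :
    Detects (stabilizedSpace χ S ω) (errorOp χ w) := by
  refine ⟨0, fun φ hφ ψ hψ => ?_⟩
  rw [zero_mul]
  have h1 : inner ℂ φ (errorOp χ w ψ)
      = χ (∑ i, (u.2 i * w.1 i - w.2 i * u.1 i)) * inner ℂ φ (errorOp χ w ψ) := by
    have e1 : inner ℂ φ (errorOp χ w ψ)
        = inner ℂ ((ω u • errorOp χ u) φ) ((ω u • errorOp χ u) (errorOp χ w ψ)) := by
      rw [LinearMap.smul_apply, LinearMap.smul_apply, inner_smul_left, inner_smul_right,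
        errorOp_inner, ← mul_assoc, RCLike.conj_mul, hnorm]
      simp
    have e2 : (ω u • errorOp χ u) (errorOp χ w ψ)
        = χ (∑ i, (u.2 i * w.1 i - w.2 i * u.1 i)) • errorOp χ w ψ := by
      conv_rhs => rw [← hψ u hu]
      rw [LinearMap.smul_apply, LinearMap.smul_apply, errorOp_comm, map_smul, smul_comm]
    rwa [hφ u hu, e2, inner_smul_right] at e1
  have h2 : (χ (∑ i, (u.2 i * w.1 i - w.2 i * u.1 i)) - 1) * inner ℂ φ (errorOp χ w ψ) = 0 := by
    rw [sub_mul, ← h1]; ring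
  exact (mul_eq_zero.1 h2).resolve_left (sub_ne_zero.2 h)

theorem detects_of_mem {w : (Fin n → F) × (Fin n → F)} (hnorm : ‖ω w‖ = 1) (hw : w ∈ S) :
    Detects (stabilizedSpace χ S ω) (errorOp χ w) := by
  refine ⟨(ω w)⁻¹, fun φ _ ψ hψ => ?_⟩
  have h0 : ω w ≠ 0 := fun h0 => by simp [h0] at hnorm
  have h := hψ w hw
  rw [LinearMap.smul_apply] at h
  conv_rhs => rw [← h]
  rw [inner_smul_right, inv_mul_cancel_left₀ h0]

/-- Such an error preserves the code, so detection would make it a scalar `c` there. But `errorOp χ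
w` times the projector is a combination of nonidentity errors, hence traceless; so `c = 0`,
contradicting unitarity on a nonzero code. -/
theorem not_detects_of_commute
    (hmul : ∀ u ∈ S, ∀ w ∈ S,
      (ω u • errorOp χ u) ∘ₗ (ω w • errorOp χ w) = ω (u + w) • errorOp χ (u + w))
    (hχ : χ ≠ 1) {w : (Fin n → F) × (Fin n → F)} (hw : w ∉ S)
    (hQ : stabilizedSpace χ S ω ≠ ⊥)
    (h : ∀ u ∈ S, χ (∑ i, (u.2 i * w.1 i - w.2 i * u.1 i)) = 1) :
    ¬ Detects (stabilizedSpace χ S ω) (errorOp χ w) := by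
  classical
  rintro ⟨c, hc⟩
  have hmem : ∀ ψ ∈ stabilizedSpace χ S ω, errorOp χ w ψ ∈ stabilizedSpace χ S ω := by
    intro ψ hψ u hu
    conv_rhs => rw [← hψ u hu]
    rw [LinearMap.smul_apply, LinearMap.smul_apply, errorOp_comm, h u hu, one_smul, map_smul]
  have hscal : ∀ ψ ∈ stabilizedSpace χ S ω, errorOp χ w ψ = c • ψ := by
    intro ψ hψ
    rw [← sub_eq_zero]
    have hm := Submodule.sub_mem _ (hmem ψ hψ) (Submodule.smul_mem _ c hψ)
    have := hc _ hm ψ hψ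
    rw [← inner_smul_right, ← sub_eq_zero, ← inner_sub_right, inner_self_eq_zero] at this
    exact this
  have hproj := stabilizerProjector_isProj (χ := χ) hmul
  have hcomp : errorOp χ w ∘ₗ stabilizerProjector χ S ω = c • stabilizerProjector χ S ω :=
    LinearMap.ext fun ψ => hscal _ (hproj.map_mem ψ)
  have htr := congrArg (LinearMap.trace ℂ (QuditSpace F n)) hcomp
  rw [map_smul, hproj.trace] at htr
  have hzero : LinearMap.trace ℂ (QuditSpace F n)
      (errorOp χ w ∘ₗ stabilizerProjector χ S ω) = 0 := by
    have e : errorOp χ w ∘ₗ stabilizerProjector χ S ω = (Fintype.card S : ℂ)⁻¹ •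
        ∑ u : S, (ω u * χ (∑ i, w.2 i * u.1.1 i)) • errorOp χ (w + u.1) := by
      refine LinearMap.ext fun ψ => ?_
      simp only [stabilizerProjector, LinearMap.comp_apply, LinearMap.smul_apply,
        LinearMap.sum_apply, map_smul, map_sum, errorOp_mul, smul_smul]
    rw [e, map_smul, map_sum, Finset.sum_eq_zero, smul_zero]
    intro u _
    rw [map_smul, trace_errorOp hχ, smul_zero]
    intro h0
    exact hw (eq_neg_of_add_eq_zero_left h0 ▸ S.neg_mem u.2)
  rw [hzero, smul_eq_mul, eq_comm, mul_eq_zero] at htr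
  obtain ⟨ψ, hψ, hψ0⟩ := Submodule.exists_mem_ne_zero_of_ne_bot hQ
  rcases htr with h0 | h0
  · have h1 := errorOp_inner χ w ψ ψ
    rw [hscal ψ hψ, h0, zero_smul, inner_zero_left] at h1
    exact hψ0 (inner_self_eq_zero.1 h1.symm)
  · exact hQ (Submodule.finrank_eq_zero.1 (by exact_mod_cast h0))

end Stabilizer

/-! ### The Hermitian dual: dimension and biduality. -/

section HermitianDual

variable {F K : Type*} [Field F] [Fintype F] [Field K] [Algebra F K] {n : ℕ}

theorem sum_pow_card_base {ι : Type*} (s : Finset ι) (f : ι → K) :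
    (∑ i ∈ s, f i) ^ Fintype.card F = ∑ i ∈ s, f i ^ Fintype.card F :=
  map_sum (FiniteField.frobeniusAlgHom F K) f s

theorem pow_card_base_pow_card_base {F K : Type*} [Fintype F] [Field K] [Fintype K]
    (hK : Fintype.card K = Fintype.card F ^ 2) (x : K) :
    (x ^ Fintype.card F) ^ Fintype.card F = x := by
  rw [← pow_mul, ← sq, ← hK, FiniteField.pow_card]

theorem algebraMap_pow_card_base (a : F) :
    algebraMap F K a ^ Fintype.card F = algebraMap F K a := by
  rw [← map_pow, FiniteField.pow_card]

theorem hermitianForm_pow [Fintype K] (hK : Fintype.card K = Fintype.card F ^ 2) (x y : Fin n → K) :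
    (∑ i, x i * y i ^ Fintype.card F) ^ Fintype.card F = ∑ i, y i * x i ^ Fintype.card F := by
  rw [sum_pow_card_base]
  refine Finset.sum_congr rfl fun i _ => ?_
  rw [mul_pow, pow_card_base_pow_card_base hK, mul_comm]

theorem hermitianForm_eq_zero_comm [Fintype K] (hK : Fintype.card K = Fintype.card F ^ 2) {x y : Fin n → K}
    (h : ∑ i, x i * y i ^ Fintype.card F = 0) : ∑ i, y i * x i ^ Fintype.card F = 0 := by
  rw [← hermitianForm_pow hK, h, zero_pow Fintype.card_ne_zero]

theorem le_hermitianDual_hermitianDual [Fintype K] (hK : Fintype.card K = Fintype.card F ^ 2)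
    (C : Submodule K (Fin n → K)) :
    C ≤ hermitianDual (Fintype.card F) (hermitianDual (Fintype.card F) C) :=
  fun x hx _ hy => hermitianForm_eq_zero_comm hK (hy x hx)

/-- Coordinatewise Frobenius maps the Hermitian dual bijectively onto the orthogonal complement for
the dot product. It is only semilinear over `K`, so the dimensions are compared through
cardinalities. -/
theorem finrank_hermitianDual [Fintype K] (hK : Fintype.card K = Fintype.card F ^ 2)
    (C : Submodule K (Fin n → K)) :
    Module.finrank K (hermitianDual (Fintype.card F) C) = n - Module.finrank K C := by
  classical
  let B : LinearMap.BilinForm K (Fin n → K) := dotProductBilin K K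
  have hB : B.Nondegenerate := by
    have hsep : ∀ x : Fin n → K, (∀ y, B x y = 0) → x = 0 :=
      fun x hx => dotProduct_eq_zero x hx
    refine ⟨hsep, fun y hy => hsep y fun x => ?_⟩
    rw [← hy x]
    exact dotProduct_comm y x
  have hfr := LinearMap.BilinForm.finrank_orthogonal hB C
  rw [Module.finrank_fin_fun] at hfr
  rw [← hfr]
  have hinv : ∀ x : Fin n → K, (fun i => (x i ^ Fintype.card F) ^ Fintype.card F) = x :=
    fun x => funext fun i => pow_card_base_pow_card_base hK _
  let e : hermitianDual (Fintype.card F) C ≃ B.orthogonal C :=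
    { toFun := fun x => ⟨fun i => x.1 i ^ Fintype.card F, fun y hy =>
        hermitianForm_eq_zero_comm hK (x.2 y hy)⟩
      invFun := fun x => ⟨fun i => x.1 i ^ Fintype.card F, fun y hy => by
        have h : ∑ i, y i * x.1 i = 0 := x.2 y hy
        have h2 := congrArg (· ^ Fintype.card F) h
        simp only [sum_pow_card_base, zero_pow Fintype.card_ne_zero, mul_pow] at h2
        simpa only [mul_comm] using h2⟩
      left_inv := fun x => Subtype.ext (hinv x.1)
      right_inv := fun x => Subtype.ext (hinv x.1) }
  have hcard := Nat.card_congr e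
  rw [Nat.card_eq_fintype_card, Nat.card_eq_fintype_card,
    Module.card_eq_pow_finrank (K := K) (V := hermitianDual (Fintype.card F) C),
    Module.card_eq_pow_finrank (K := K) (V := B.orthogonal C)] at hcard
  exact Nat.pow_right_injective Fintype.one_lt_card hcard

theorem hermitianDual_hermitianDual [Fintype K] (hK : Fintype.card K = Fintype.card F ^ 2)
    (C : Submodule K (Fin n → K)) :
    hermitianDual (Fintype.card F) (hermitianDual (Fintype.card F) C) = C := by
  refine (Submodule.eq_of_le_of_finrank_eq (le_hermitianDual_hermitianDual hK C) ?_).symm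
  rw [finrank_hermitianDual hK, finrank_hermitianDual hK]
  have := Submodule.finrank_le C
  rw [Module.finrank_fin_fun] at this
  omega

end HermitianDual

/-! ### From the symplectic form over `F` to the Hermitian form over `K`. -/

section ToExtension

variable {F K : Type*} [Field F] [Fintype F] [Field K] [Algebra F K] {n : ℕ} {β : K}

theorem toExtension_add (u w : (Fin n → F) × (Fin n → F)) :
    toExtension β (u + w) = toExtension β u + toExtension β w := by
  funext i
  simp only [toExtension, Prod.fst_add, Prod.snd_add, Pi.add_apply, add_smul]
  ring

theorem toExtension_zero : toExtension β (0 : (Fin n → F) × (Fin n → F)) = 0 := by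
  funext i
  simp [toExtension]

theorem toExtension_apply_eq_zero (hβ : LinearIndependent F ![β, β ^ Fintype.card F])
    (u : (Fin n → F) × (Fin n → F)) (i : Fin n) :
    toExtension β u i = 0 ↔ (u.1 i, u.2 i) = 0 := by
  refine ⟨fun h => ?_, fun h => ?_⟩
  · have := LinearIndependent.pair_iff.1 hβ _ _ h
    exact Prod.ext this.1 this.2
  · have h1 : u.1 i = 0 := congrArg Prod.fst h
    have h2 : u.2 i = 0 := congrArg Prod.snd h
    simp [toExtension, h1, h2]

theorem errorWeight_eq_hammingNorm [DecidableEq F] [DecidableEq K]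
    (hβ : LinearIndependent F ![β, β ^ Fintype.card F]) (u : (Fin n → F) × (Fin n → F)) :
    errorWeight u = hammingNorm (toExtension β u) := by
  unfold errorWeight hammingNorm
  congr 1
  ext i
  simp only [Finset.mem_filter, Finset.mem_univ, true_and, ne_eq, toExtension_apply_eq_zero hβ]

theorem toExtension_bijective [Fintype K] (hK : Fintype.card K = Fintype.card F ^ 2)
    (hβ : LinearIndependent F ![β, β ^ Fintype.card F]) :
    Function.Bijective (toExtension (n := n) (F := F) β) := by
  classical
  rw [Fintype.bijective_iff_injective_and_card]
  constructor
  · intro u w h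
    have h0 : toExtension β (u - w) = 0 := by
      have := toExtension_add (β := β) (u - w) w
      rw [sub_add_cancel, h] at this
      exact left_eq_add.1 (this.trans (add_comm _ _))
    rw [← sub_eq_zero]
    refine Prod.ext (funext fun i => ?_) (funext fun i => ?_)
    · exact congrArg Prod.fst ((toExtension_apply_eq_zero hβ _ i).1 (congrFun h0 i))
    · exact congrArg Prod.snd ((toExtension_apply_eq_zero hβ _ i).1 (congrFun h0 i))
  · simp only [Fintype.card_prod, Fintype.card_fun, Fintype.card_fin, hK]
    ring

theorem sq_sub_ne_zero_of_linearIndependent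
    (hβ : LinearIndependent F ![β, β ^ Fintype.card F]) :
    β ^ 2 - (β ^ Fintype.card F) ^ 2 ≠ 0 := by
  intro h
  rw [LinearIndependent.pair_iff] at hβ
  rw [sq_sub_sq, mul_eq_zero] at h
  rcases h with h | h
  · exact one_ne_zero (hβ 1 1 (by simpa using h)).1
  · exact one_ne_zero (hβ 1 (-1) (by simpa [← sub_eq_add_neg] using h)).1

/-- Antisymmetrizing the Hermitian form under Frobenius recovers the symplectic form that governs
commutation, up to a constant that is nonzero for a normal basis. -/
theorem hermitianForm_sub_pow [Fintype K] (hK : Fintype.card K = Fintype.card F ^ 2)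
    (u w : (Fin n → F) × (Fin n → F)) :
    (∑ i, toExtension β w i * toExtension β u i ^ Fintype.card F)
      - (∑ i, toExtension β w i * toExtension β u i ^ Fintype.card F) ^ Fintype.card F
      = algebraMap F K (∑ i, (u.2 i * w.1 i - w.2 i * u.1 i))
        * (β ^ 2 - (β ^ Fintype.card F) ^ 2) := by
  rw [hermitianForm_pow hK, ← Finset.sum_sub_distrib, map_sum, Finset.sum_mul]
  refine Finset.sum_congr rfl fun i _ => ?_
  have hpow : ∀ u : (Fin n → F) × (Fin n → F), toExtension β u i ^ Fintype.card F
      = algebraMap F K (u.1 i) * β ^ Fintype.card F + algebraMap F K (u.2 i) * β := by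
    intro u
    have := map_add (FiniteField.frobeniusAlgHom F K) (u.1 i • β) (u.2 i • β ^ Fintype.card F)
    rw [map_smul, map_smul] at this
    simp only [FiniteField.coe_frobeniusAlgHom, pow_card_base_pow_card_base hK,
      Algebra.smul_def] at this
    simpa only [toExtension, Algebra.smul_def] using this
  rw [hpow, hpow]
  simp only [toExtension, Algebra.smul_def, map_sub, map_mul]
  ring

/-- The pairs `(a, b)` that correspond to words of `D`. -/
def extensionPreimage (F : Type*) [Field F] [Fintype F] [Algebra F K] (β : K)
    (D : Submodule K (Fin n → K)) : AddSubgroup ((Fin n → F) × (Fin n → F)) where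
  carrier := {u | toExtension β u ∈ D}
  add_mem' := by
    intro u w hu hw
    rw [Set.mem_ofPred_eq, toExtension_add]
    exact D.add_mem hu hw
  zero_mem' := by
    rw [Set.mem_ofPred_eq, toExtension_zero]
    exact D.zero_mem
  neg_mem' := by
    intro u hu
    have h : toExtension β (-u) = -toExtension β u := by
      rw [eq_neg_iff_add_eq_zero, ← toExtension_add, neg_add_cancel, toExtension_zero]
    rw [Set.mem_ofPred_eq, h]
    exact D.neg_mem hu

theorem mem_extensionPreimage {D : Submodule K (Fin n → K)} {u : (Fin n → F) × (Fin n → F)} :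
    u ∈ extensionPreimage F β D ↔ toExtension β u ∈ D := Iff.rfl

theorem card_extensionPreimage [Fintype K] (hK : Fintype.card K = Fintype.card F ^ 2)
    (hβ : LinearIndependent F ![β, β ^ Fintype.card F]) (D : Submodule K (Fin n → K)) :
    Nat.card (extensionPreimage F β D) = (Fintype.card F ^ 2) ^ Module.finrank K D := by
  classical
  have e : extensionPreimage F β D ≃ D :=
    (Equiv.ofBijective _ (toExtension_bijective (n := n) hK hβ)).subtypeEquiv fun u => Iff.rfl
  rw [Nat.card_congr e, Nat.card_eq_fintype_card, Module.card_eq_pow_finrank (K := K), hK]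

theorem symplecticForm_eq_zero_of_hermitianForm_eq_zero [Fintype K]
    (hK : Fintype.card K = Fintype.card F ^ 2)
    (hβ : LinearIndependent F ![β, β ^ Fintype.card F]) {u w : (Fin n → F) × (Fin n → F)}
    (h : ∑ i, toExtension β w i * toExtension β u i ^ Fintype.card F = 0) :
    ∑ i, (u.2 i * w.1 i - w.2 i * u.1 i) = 0 := by
  have h1 := hermitianForm_sub_pow (β := β) hK u w
  rw [h, zero_pow Fintype.card_ne_zero, sub_zero, eq_comm, mul_eq_zero] at h1
  exact (map_eq_zero _).1 (h1.resolve_right (sq_sub_ne_zero_of_linearIndependent hβ))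

theorem exists_symplecticForm_eq [Fintype K] (hK : Fintype.card K = Fintype.card F ^ 2)
    (hβ : LinearIndependent F ![β, β ^ Fintype.card F]) {D : Submodule K (Fin n → K)}
    {w : (Fin n → F) × (Fin n → F)} (hw : toExtension β w ∉ hermitianDual (Fintype.card F) D)
    (a : F) :
    ∃ u ∈ extensionPreimage F β D, ∑ i, (u.2 i * w.1 i - w.2 i * u.1 i) = a := by
  have hw' : ∃ y ∈ D, ∑ i, toExtension β w i * y i ^ Fintype.card F ≠ 0 := by
    by_contra! hcon
    exact hw hcon
  obtain ⟨y, hy, hne⟩ := hw'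
  set h := ∑ i, toExtension β w i * y i ^ Fintype.card F with hh
  -- `D` is a `K`-space, so `y` may be rescaled to give the Hermitian form the value `a * β ^ 2`.
  -- The scalar carries an extra Frobenius power because the form is conjugate-linear in `y`.
  obtain ⟨u, hu⟩ := (toExtension_bijective (n := n) hK hβ).2
    ((algebraMap F K a * β ^ 2 / h) ^ Fintype.card F • y)
  refine ⟨u, ?_, ?_⟩
  · rw [mem_extensionPreimage, hu]
    exact D.smul_mem _ hy
  · have h1 := hermitianForm_sub_pow (β := β) hK u w
    have h2 : ∑ i, toExtension β w i * toExtension β u i ^ Fintype.card F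
        = algebraMap F K a * β ^ 2 := by
      rw [hu]
      simp only [Pi.smul_apply, smul_eq_mul, mul_pow _ (y _), pow_card_base_pow_card_base hK]
      calc ∑ i, toExtension β w i * (algebraMap F K a * β ^ 2 / h * y i ^ Fintype.card F)
          = algebraMap F K a * β ^ 2 / h * h := by
            conv_rhs => rw [hh, Finset.mul_sum]
            exact Finset.sum_congr rfl fun i _ => by ring
        _ = algebraMap F K a * β ^ 2 := div_mul_cancel₀ _ hne
    rw [h2, mul_pow, algebraMap_pow_card_base, ← pow_mul, mul_comm 2, pow_mul, ← mul_sub] at h1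
    exact (algebraMap F K).injective
      (mul_right_cancel₀ (sq_sub_ne_zero_of_linearIndependent hβ) h1).symm

end ToExtension

/-- The stabilizer code of a Hermitian dual-containing code. -/
theorem exists_isQuantumCode_isInducedBy {F K : Type*} [Field F] [Fintype F] [DecidableEq F]
    [Field K] [Fintype K] [DecidableEq K] [Algebra F K] {n k d : ℕ} {χ : AddChar F ℂ} {β : K}
    (hK : Fintype.card K = Fintype.card F ^ 2) (hχ : χ ≠ 1)
    (hβ : LinearIndependent F ![β, β ^ Fintype.card F]) (C : Submodule K (Fin n → K))
    (hC : hermitianDual (Fintype.card F) C ≤ C) (hk : 2 * Module.finrank K C = n + k)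
    (hle : ∀ c ∈ C, c ∉ hermitianDual (Fintype.card F) C → d ≤ hammingNorm c)
    (hex : ∃ c ∈ C, c ∉ hermitianDual (Fintype.card F) C ∧ hammingNorm c = d) :
    ∃ Q : Submodule ℂ (QuditSpace F n), IsQuantumCode χ Q k d ∧ IsInducedBy χ β C Q := by
  have horth : ∀ u ∈ extensionPreimage F β (hermitianDual (Fintype.card F) C),
      ∀ w, toExtension β w ∈ C → ∑ i, (u.2 i * w.1 i - w.2 i * u.1 i) = 0 :=
    fun u hu w hw => symplecticForm_eq_zero_of_hermitianForm_eq_zero hK hβ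
      (hermitianForm_eq_zero_comm hK (hu _ hw))
  obtain ⟨ω, hnorm, hmul⟩ := exists_stabilizer_phases (χ := χ)
    (extensionPreimage F β (hermitianDual (Fintype.card F) C)) fun u hu w hw => by
      rw [horth u hu w (hC hw), AddChar.map_zero_eq_one]
  have hcard := card_mul_finrank_stabilizedSpace hnorm hmul hχ
  rw [card_extensionPreimage hK hβ, finrank_hermitianDual hK, ← pow_mul] at hcard
  have hCn := Submodule.finrank_le C
  rw [Module.finrank_fin_fun] at hCn
  have hdim : Module.finrank ℂ (stabilizedSpace χ
      (extensionPreimage F β (hermitianDual (Fintype.card F) C)) ω) = Fintype.card F ^ k := by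
    have hn : n = 2 * (n - Module.finrank K C) + k := by omega
    have hpow : Fintype.card F ^ n
        = Fintype.card F ^ (2 * (n - Module.finrank K C)) * Fintype.card F ^ k := by
      rw [← pow_add]
      exact congrArg _ hn
    rw [hpow] at hcard
    exact Nat.eq_of_mul_eq_mul_left (pow_pos Fintype.card_pos _) hcard
  refine ⟨stabilizedSpace χ (extensionPreimage F β (hermitianDual (Fintype.card F) C)) ω,
    ⟨hdim, ?_, ?_⟩, ω, fun u hu => hnorm u hu, fun u w hu hw => hmul u hu w hw, fun ψ => Iff.rfl⟩
  · obtain ⟨c, hc, hc', hcd⟩ := hex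
    obtain ⟨w, rfl⟩ := (toExtension_bijective (n := n) hK hβ).2 c
    refine ⟨w, not_detects_of_commute hmul hχ hc' ?_ fun u hu => ?_, ?_⟩
    · intro h0
      rw [Submodule.finrank_eq_zero.2 h0] at hdim
      exact (pow_pos Fintype.card_pos k).ne hdim
    · rw [horth u hu w hc, AddChar.map_zero_eq_one]
    · rw [errorWeight_eq_hammingNorm hβ, hcd]
  · rintro _ ⟨w, hw, rfl⟩
    rw [errorWeight_eq_hammingNorm hβ]
    refine hle _ ?_ fun hmem => hw (detects_of_mem (hnorm w hmem) hmem)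
    -- By biduality, a word outside `C` pairs nontrivially with the dual. The symplectic form then
    -- takes every value in `F`, including one where `χ` is not `1`.
    by_contra hwC
    rw [← hermitianDual_hermitianDual hK C] at hwC
    obtain ⟨a, ha⟩ := AddChar.ne_one_iff.1 hχ
    obtain ⟨u, hu, hua⟩ := exists_symplecticForm_eq hK hβ hwC a
    exact hw (detects_of_not_commute (hnorm u hu) hu (by rwa [hua]))

/-! ### Vandermonde arguments at distinct nonzero points. -/

section Vandermonde

variable {K ι : Type*} [Field K]

theorem eq_zero_of_sum_mul_pow_eq_zero [DecidableEq K] {J : Finset ι} {y z : ι → K} {m : ℕ}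
    (hinj : Set.InjOn z J) (h0 : ∀ j ∈ J, z j ≠ 0)
    (hsum : ∀ i < m, ∑ j ∈ J, y j * z j ^ (i + 1) = 0)
    (hcard : (J.filter fun j => y j ≠ 0).card ≤ m) : ∀ j ∈ J, y j = 0 := by
  classical
  by_contra! hcon
  obtain ⟨j₀, hj₀, hy₀⟩ := hcon
  set T := J.filter fun j => y j ≠ 0 with hT
  have hj₀T : j₀ ∈ T := Finset.mem_filter.2 ⟨hj₀, hy₀⟩
  -- `X * p` isolates the term at `j₀`; the factor `X` is there because the given powers start at
  -- exponent `1`.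
  let p : Polynomial K := ∏ j ∈ T.erase j₀, (Polynomial.X - Polynomial.C (z j))
  have hdeg : p.natDegree < m := by
    rw [Polynomial.natDegree_finsetProd_X_sub_C_eq_card]
    exact (Finset.card_erase_lt_of_mem hj₀T).trans_le hcard
  have hp : ∀ w : K, p.eval w = ∏ j ∈ T.erase j₀, (w - z j) := fun w => by
    simp [p, Polynomial.eval_prod]
  have hzero : ∑ j ∈ J, y j * (z j * p.eval (z j)) = 0 := by
    simp only [Polynomial.eval_eq_sum_range' hdeg, Finset.mul_sum]
    rw [Finset.sum_comm]
    refine Finset.sum_eq_zero fun i hi => ?_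
    rw [← mul_zero (p.coeff i), ← hsum i (Finset.mem_range.1 hi), Finset.mul_sum]
    exact Finset.sum_congr rfl fun j _ => by ring
  rw [Finset.sum_eq_single j₀] at hzero
  · rw [hp] at hzero
    refine mul_ne_zero hy₀ (mul_ne_zero (h0 j₀ hj₀) (Finset.prod_ne_zero_iff.2 fun j hj => ?_)) hzero
    rw [sub_ne_zero]
    intro h
    have hjT := Finset.mem_of_mem_erase hj
    exact (Finset.ne_of_mem_erase hj) (hinj (Finset.mem_filter.1 hjT).1 hj₀ h.symm)
  · intro j hj hne
    by_cases hyj : y j = 0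
    · rw [hyj, zero_mul]
    · rw [hp, Finset.prod_eq_zero (Finset.mem_erase.2 ⟨hne, Finset.mem_filter.2 ⟨hj, hyj⟩⟩)
        (sub_self _), mul_zero, mul_zero]
  · exact fun h => absurd hj₀ h

theorem eq_zero_of_forall_sum_mul_pow_eq_zero {J : Finset ι} {z : ι → K} {m : ℕ}
    (hinj : Set.InjOn z J) (h0 : ∀ j ∈ J, z j ≠ 0) (hcard : m ≤ J.card) {a : Fin m → K}
    (h : ∀ j ∈ J, ∑ i, a i * z j ^ ((i : ℕ) + 1) = 0) : a = 0 := by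
  let p : Polynomial K := ∑ i, Polynomial.C (a i) * Polynomial.X ^ (i : ℕ)
  have hp : p = 0 := by
    refine Polynomial.eq_zero_of_degree_lt_of_eval_index_eq_zero J hinj ?_ ?_
    · refine lt_of_lt_of_le ?_ (Nat.cast_le.2 hcard)
      exact Polynomial.degree_sum_fin_lt a
    · intro j hj
      have := h j hj
      simp only [pow_succ, ← mul_assoc, ← Finset.sum_mul] at this
      simpa [p, Polynomial.eval_finsetSum] using (mul_eq_zero.1 this).resolve_right (h0 j hj)
  funext i
  have := congrArg (fun r => Polynomial.coeff r i) hp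
  simpa [p, Polynomial.finsetSum_coeff, Polynomial.coeff_X_pow, Fin.val_inj] using this

end Vandermonde

/-! ### The check code, its Hermitian dual and their distances. -/

section BlockCode

variable {F K B : Type*} [Field F] [Fintype F] [Field K] [Algebra F K] [DecidableEq B]
  {n : ℕ} (blk : Fin n → B) (x : Fin n → K) (γ : B → K) (s l : ℕ)

/-- The local checks `x ^ (i + 1)`, `i < s`, on every block, and the global checks
`γ * x ^ (s + i + 1)`, `i < l`. -/
def checkRow : (B × Fin s) ⊕ Fin l → Fin n → K :=
  Sum.elim (fun p j => if blk j = p.1 then x j ^ ((p.2 : ℕ) + 1) else 0)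
    (fun i j => γ (blk j) * x j ^ (s + (i : ℕ) + 1))

/-- The code spanned by the checks. -/
def checkCode : Submodule K (Fin n → K) := Submodule.span K (Set.range (checkRow blk x γ s l))

/-- The positions in a block. -/
def blockPositions (b : B) : Finset (Fin n) := Finset.univ.filter fun j => blk j = b

variable {blk x γ s l}

theorem mem_blockPositions {b : B} {j : Fin n} : j ∈ blockPositions blk b ↔ blk j = b := by
  simp [blockPositions]

theorem sum_smul_checkRow_apply [Fintype B] (g : (B × Fin s) ⊕ Fin l → K) (j : Fin n) :
    (∑ r, g r • checkRow blk x γ s l r) j =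
      ∑ i, Fin.append (fun i => g (Sum.inl (blk j, i))) (fun i => γ (blk j) * g (Sum.inr i)) i
        * x j ^ ((i : ℕ) + 1) := by
  rw [Finset.sum_apply, Fintype.sum_sum_type, Fin.sum_univ_add, Fintype.sum_prod_type,
    Finset.sum_eq_single (blk j)]
  · simp only [Pi.smul_apply, checkRow, Sum.elim_inl, Sum.elim_inr, smul_eq_mul, if_true,
      Fin.append_left, Fin.append_right, Fin.val_castAdd, Fin.val_natAdd]
    congr 1
    exact Finset.sum_congr rfl fun i _ => by ring
  · intro b _ hb
    refine Finset.sum_eq_zero fun i _ => ?_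
    simp [checkRow, hb.symm]
  · simp

theorem linearIndependent_checkRow [Fintype B] [Nonempty B]
    (hinj : ∀ b, Set.InjOn x (blockPositions blk b)) (h0 : ∀ j, x j ≠ 0) (hγ : ∀ b, γ b ≠ 0)
    (hcard : ∀ b, s + l ≤ (blockPositions blk b).card) :
    LinearIndependent K (checkRow blk x γ s l) := by
  rw [Fintype.linearIndependent_iff]
  intro g hg
  have hz : ∀ b, Fin.append (fun i => g (Sum.inl (b, i))) (fun i => γ b * g (Sum.inr i)) = 0 := by
    intro b
    refine eq_zero_of_forall_sum_mul_pow_eq_zero (hinj b) (fun j _ => h0 j) (hcard b) ?_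
    intro j hj
    rw [mem_blockPositions] at hj
    subst hj
    rw [← sum_smul_checkRow_apply, hg, Pi.zero_apply]
  rintro (⟨b, i⟩ | i)
  · simpa using congrFun (hz b) (Fin.castAdd l i)
  · have b := Classical.arbitrary B
    simpa [hγ b] using congrFun (hz b) (Fin.natAdd s i)

theorem finrank_checkCode [Fintype B] [Nonempty B]
    (hinj : ∀ b, Set.InjOn x (blockPositions blk b)) (h0 : ∀ j, x j ≠ 0) (hγ : ∀ b, γ b ≠ 0)
    (hcard : ∀ b, s + l ≤ (blockPositions blk b).card) :
    Module.finrank K (checkCode blk x γ s l) = Fintype.card B * s + l := by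
  rw [checkCode, finrank_span_eq_card (linearIndependent_checkRow hinj h0 hγ hcard)]
  simp

/-- On each block a word is a polynomial of degree at most `s + l` without constant term. If it is
nonzero there, it has fewer than `s + l` zeros at the nonzero evaluation points. -/
theorem le_hammingNorm_of_mem_checkCode [Fintype B] [DecidableEq K]
    (hinj : ∀ b, Set.InjOn x (blockPositions blk b)) (h0 : ∀ j, x j ≠ 0) {m : ℕ}
    (hcard : ∀ b, m ≤ (blockPositions blk b).card) {c : Fin n → K}
    (hc : c ∈ checkCode blk x γ s l) (hc0 : c ≠ 0) : m + 1 ≤ hammingNorm c + (s + l) := by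
  obtain ⟨g, rfl⟩ := (Submodule.mem_span_range_iff_exists_fun K).1 hc
  set c := ∑ r, g r • checkRow blk x γ s l r with hcdef
  obtain ⟨j₀, hj₀⟩ := Function.ne_iff.1 hc0
  have hzeros : ((blockPositions blk (blk j₀)).filter fun j => c j = 0).card < s + l := by
    by_contra! hle
    refine hj₀ ?_
    have hz := eq_zero_of_forall_sum_mul_pow_eq_zero (z := x)
      (a := Fin.append (fun i => g (Sum.inl (blk j₀, i))) (fun i => γ (blk j₀) * g (Sum.inr i)))
      ((hinj (blk j₀)).mono (fun j hj => (Finset.mem_filter.1 hj).1)) (fun j _ => h0 j) hle ?_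
    · rw [hcdef, sum_smul_checkRow_apply, hz]
      simp
    · intro j hj
      obtain ⟨hj1, hj2⟩ := Finset.mem_filter.1 hj
      rw [mem_blockPositions] at hj1
      rw [← hj1, ← sum_smul_checkRow_apply, ← hcdef, hj2]
  have hsplit := Finset.card_filter_add_card_filter_not (s := blockPositions blk (blk j₀))
    (fun j => c j = 0)
  have hle : ((blockPositions blk (blk j₀)).filter fun j => ¬ c j = 0).card ≤ hammingNorm c :=
    Finset.card_le_card fun j hj => by simpa using (Finset.mem_filter.1 hj).2
  have := hcard (blk j₀)
  omega

theorem mem_hermitianDual_checkCode {y : Fin n → K} :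
    y ∈ hermitianDual (Fintype.card F) (checkCode blk x γ s l) ↔
      ∀ r, ∑ j, y j * checkRow blk x γ s l r j ^ Fintype.card F = 0 := by
  refine ⟨fun h r => h _ (Submodule.subset_span ⟨r, rfl⟩), fun h c hc => ?_⟩
  induction hc using Submodule.span_induction with
  | mem c hc =>
    obtain ⟨r, rfl⟩ := hc
    exact h r
  | zero => simp [Fintype.card_ne_zero]
  | add c c' _ _ hc hc' =>
    have hadd : ∀ a b : K, (a + b) ^ Fintype.card F = a ^ Fintype.card F + b ^ Fintype.card F :=
      fun a b => map_add (FiniteField.frobeniusAlgHom F K) a b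
    simp only [Pi.add_apply, hadd, mul_add, Finset.sum_add_distrib, hc, hc', add_zero]
  | smul a c _ hc =>
    simp only [Pi.smul_apply, smul_eq_mul, mul_pow, mul_left_comm _ (a ^ _), ← Finset.mul_sum, hc,
      mul_zero]

theorem checkCode_le_hermitianDual [Fintype K] (hK : Fintype.card K = Fintype.card F ^ 2)
    (hloc : ∀ (w : B → K) (m m' : ℕ), 1 ≤ m → 1 ≤ m' → m + m' ≤ 2 * s + l →
      ∑ j, w (blk j) * (x j ^ m * (x j ^ m') ^ Fintype.card F) = 0)
    (hglob : ∀ m m' : ℕ, ∑ j, (γ (blk j) * γ (blk j) ^ Fintype.card F) *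
      (x j ^ m * (x j ^ m') ^ Fintype.card F) = 0) :
    checkCode blk x γ s l ≤ hermitianDual (Fintype.card F) (checkCode blk x γ s l) := by
  have hlocal : ∀ (p : B × Fin s) (r : (B × Fin s) ⊕ Fin l),
      ∑ j, checkRow blk x γ s l (Sum.inl p) j * checkRow blk x γ s l r j ^ Fintype.card F = 0 := by
    rintro ⟨b, i⟩ (⟨b', i'⟩ | i')
    -- The weight `w` localizes the sum to the common block, and is zero if the blocks differ.
    · rw [← hloc (fun c => if c = b then if c = b' then 1 else 0 else 0) (i + 1) (i' + 1)
        (by omega) (by omega) (by omega)]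
      refine Finset.sum_congr rfl fun j _ => ?_
      simp only [checkRow, Sum.elim_inl]
      split_ifs <;> simp [Fintype.card_ne_zero]
    · rw [← hloc (fun c => if c = b then γ c ^ Fintype.card F else 0) (i + 1) (s + i' + 1)
        (by omega) (by omega) (by omega)]
      refine Finset.sum_congr rfl fun j _ => ?_
      simp only [checkRow, Sum.elim_inl, Sum.elim_inr]
      split_ifs <;> ring
  rw [checkCode, Submodule.span_le]
  rintro _ ⟨r, rfl⟩
  refine mem_hermitianDual_checkCode.2 fun r' => ?_
  rcases r with p | i
  · exact hlocal p r'
  rcases r' with p' | i'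
  · exact hermitianForm_eq_zero_comm hK (hlocal p' _)
  · rw [← hglob (s + i + 1) (s + i' + 1)]
    refine Finset.sum_congr rfl fun j _ => ?_
    simp only [checkRow, Sum.elim_inr]
    ring

theorem pow_card_injOn {J : Set (Fin n)} (h : Set.InjOn x J) :
    Set.InjOn (fun j => x j ^ Fintype.card F) J :=
  fun _ hi _ hj hij => h hi hj ((FiniteField.frobeniusAlgHom F K).injective hij)

theorem sum_blockPositions_eq_zero {y : Fin n → K}
    (hy : y ∈ hermitianDual (Fintype.card F) (checkCode blk x γ s l)) (b : B) {i : ℕ}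
    (hi : i < s) :
    ∑ j ∈ blockPositions blk b, y j * (x j ^ Fintype.card F) ^ (i + 1) = 0 := by
  rw [blockPositions, Finset.sum_filter]
  refine Eq.trans ?_ (mem_hermitianDual_checkCode.1 hy (Sum.inl (b, ⟨i, hi⟩)))
  refine Finset.sum_congr rfl fun j _ => ?_
  simp only [checkRow, Sum.elim_inl]
  split_ifs
  · ring
  · simp [Fintype.card_ne_zero]

theorem lt_card_filter_blockPositions [DecidableEq K]
    (hinj : ∀ b, Set.InjOn x (blockPositions blk b)) (h0 : ∀ j, x j ≠ 0) {y : Fin n → K}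
    (hy : y ∈ hermitianDual (Fintype.card F) (checkCode blk x γ s l)) {j : Fin n}
    (hj : y j ≠ 0) : s < ((blockPositions blk (blk j)).filter fun j => y j ≠ 0).card := by
  by_contra! hle
  exact hj (eq_zero_of_sum_mul_pow_eq_zero (pow_card_injOn (F := F) (hinj _))
    (fun j _ => pow_ne_zero _ (h0 j)) (fun i hi => sum_blockPositions_eq_zero hy _ hi) hle j
    (mem_blockPositions.2 rfl))

theorem minDistGE_hermitianDual_checkCode [DecidableEq K]
    (hinj : ∀ b, Set.InjOn x (blockPositions blk b)) (h0 : ∀ j, x j ≠ 0) (hγ : ∀ b, γ b ≠ 0)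
    (hl : l ≤ s + 1) :
    MinDistGE (hermitianDual (Fintype.card F) (checkCode blk x γ s l)) (s + l + 1) := by
  intro y hy hy0
  obtain ⟨j₀, hj₀⟩ := Function.ne_iff.1 hy0
  by_cases hsupp : ∃ j₁, y j₁ ≠ 0 ∧ blk j₁ ≠ blk j₀
  · obtain ⟨j₁, hj₁, hne⟩ := hsupp
    have h1 := lt_card_filter_blockPositions hinj h0 hy hj₀
    have h2 := lt_card_filter_blockPositions hinj h0 hy hj₁
    have hdisj : Disjoint ((blockPositions blk (blk j₀)).filter fun j => y j ≠ 0)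
        ((blockPositions blk (blk j₁)).filter fun j => y j ≠ 0) := by
      refine Finset.disjoint_left.2 fun j hj hj' => hne ?_
      rw [Finset.mem_filter, mem_blockPositions] at hj hj'
      exact hj'.1.symm.trans hj.1
    have hle : (((blockPositions blk (blk j₀)).filter fun j => y j ≠ 0) ∪
        ((blockPositions blk (blk j₁)).filter fun j => y j ≠ 0)).card ≤ hammingNorm y := by
      refine Finset.card_le_card (Finset.union_subset ?_ ?_) <;>
        exact Finset.filter_subset_filter _ (Finset.subset_univ _)
    rw [Finset.card_union_of_disjoint hdisj] at hle
    omega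
  · push Not at hsupp
    by_contra! hlt
    refine hj₀ (eq_zero_of_sum_mul_pow_eq_zero (m := s + l) (pow_card_injOn (F := F) (hinj _))
      (fun j _ => pow_ne_zero _ (h0 j)) ?_ ?_ j₀ (mem_blockPositions.2 rfl))
    · intro i hi
      rcases lt_or_ge i s with his | his
      · exact sum_blockPositions_eq_zero hy _ his
      · have hil : i - s < l := by omega
        have h := mem_hermitianDual_checkCode.1 hy (Sum.inr ⟨i - s, hil⟩)
        have hfac : γ (blk j₀) ^ Fintype.card F * ∑ j ∈ blockPositions blk (blk j₀),
            y j * (x j ^ Fintype.card F) ^ (i + 1) = 0 := by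
          rw [← h, blockPositions, Finset.sum_filter, Finset.mul_sum]
          refine Finset.sum_congr rfl fun j _ => ?_
          simp only [checkRow, Sum.elim_inr, Nat.add_sub_cancel' his]
          split_ifs with hb
          · rw [hb]; ring
          · have : y j = 0 := by
              by_contra hyj
              exact hb (hsupp j hyj)
            rw [this]; ring
        exact (mul_eq_zero.1 hfac).resolve_left (pow_ne_zero _ (hγ _))
    · refine le_trans (Finset.card_le_card ?_) (Nat.lt_succ_iff.1 hlt)
      exact Finset.filter_subset_filter _ (Finset.subset_univ _)

/-- A word supported on `s + l + 1` positions of one block has to satisfy only `s + l` linear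
equations. -/
theorem exists_mem_hermitianDual_checkCode_hammingNorm_le [DecidableEq K] {b : B}
    (hcard : s + l + 1 ≤ (blockPositions blk b).card) :
    ∃ y ∈ hermitianDual (Fintype.card F) (checkCode blk x γ s l),
      y ≠ 0 ∧ hammingNorm y ≤ s + l + 1 := by
  obtain ⟨T, hTb, hT⟩ := Finset.exists_subset_card_eq hcard
  let f : (T → K) →ₗ[K] (Fin (s + l) → K) :=
    LinearMap.pi fun i => ∑ j : T, (x j ^ Fintype.card F) ^ ((i : ℕ) + 1) • LinearMap.proj j
  have hker : LinearMap.ker f ≠ ⊥ := by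
    refine LinearMap.ker_ne_bot_of_finrank_lt ?_
    simp [hT]
  obtain ⟨u, hu, hu0⟩ := Submodule.exists_mem_ne_zero_of_ne_bot hker
  let y : Fin n → K := fun j => if h : j ∈ T then u ⟨j, h⟩ else 0
  have hyT : ∀ j : T, y j = u j := fun j => by simp [y]
  have hy0 : ∀ j ∉ T, y j = 0 := fun j hj => by simp [y, hj]
  have hsum : ∀ i < s + l, ∑ j ∈ T, y j * (x j ^ Fintype.card F) ^ (i + 1) = 0 := by
    intro i hi
    have h := congrFun (LinearMap.mem_ker.1 hu) ⟨i, hi⟩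
    rw [← Finset.sum_coe_sort]
    simpa [f, hyT, mul_comm] using h
  refine ⟨y, mem_hermitianDual_checkCode.2 ?_, ?_, ?_⟩
  · have hrestrict : ∀ w : Fin n → K, ∑ j, y j * w j = ∑ j ∈ T, y j * w j := fun w =>
      (Finset.sum_subset (Finset.subset_univ T) fun j _ hj => by rw [hy0 j hj, zero_mul]).symm
    have hblk : ∀ j ∈ T, blk j = b := fun j hj => mem_blockPositions.1 (hTb hj)
    rintro (⟨b', i⟩ | i)
    · rw [hrestrict]
      simp only [checkRow, Sum.elim_inl]
      by_cases hb : b = b'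
      · rw [← hsum i (by omega)]
        refine Finset.sum_congr rfl fun j hj => ?_
        rw [if_pos ((hblk j hj).trans hb)]
        ring
      · refine Finset.sum_eq_zero fun j hj => ?_
        rw [if_neg (by rwa [hblk j hj]), zero_pow Fintype.card_ne_zero, mul_zero]
    · rw [hrestrict, ← mul_zero (γ b ^ Fintype.card F), ← hsum (s + i) (by omega), Finset.mul_sum]
      refine Finset.sum_congr rfl fun j hj => ?_
      simp only [checkRow, Sum.elim_inr]
      rw [hblk j hj]
      ring
  · intro h
    exact hu0 (funext fun j => by rw [← hyT, h]; rfl)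
  · rw [← hT]
    refine Finset.card_le_card fun j hj => ?_
    by_contra hjT
    exact (Finset.mem_filter.1 hj).2 (hy0 j hjT)

theorem isLRC_hermitianDual_checkCode [DecidableEq K]
    (hinj : ∀ b, Set.InjOn x (blockPositions blk b)) (h0 : ∀ j, x j ≠ 0) {r : ℕ}
    (hcard : ∀ b, (blockPositions blk b).card ≤ r + s) :
    IsLRC (hermitianDual (Fintype.card F) (checkCode blk x γ s l)) r (s + 1) := by
  intro j
  refine ⟨blockPositions blk (blk j), mem_blockPositions.2 rfl, hcard _, ?_⟩
  rintro c ⟨y, hy, rfl⟩ hc0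
  obtain ⟨⟨j₀, hj₀⟩, hy₀⟩ := Function.ne_iff.1 hc0
  have hlt := lt_card_filter_blockPositions hinj h0 hy (j := j₀) hy₀
  rw [mem_blockPositions.1 hj₀] at hlt
  refine hlt.trans_eq (Finset.card_bij (fun i hi => ⟨i, (Finset.mem_filter.1 hi).1⟩) ?_ ?_ ?_)
  · intro i hi
    exact Finset.mem_filter.2 ⟨Finset.mem_univ _, (Finset.mem_filter.1 hi).2⟩
  · intro i _ i' _ h
    exact congrArg Subtype.val h
  · rintro ⟨i, hi⟩ hi'
    exact ⟨i, Finset.mem_filter.2 ⟨hi, (Finset.mem_filter.1 hi').2⟩, rfl⟩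

end BlockCode

/-! ### Power sums over cyclic groups and the layout of the blocks. -/

theorem exists_units_orderOf_eq (K : Type*) [Field K] [Fintype K] {N : ℕ}
    (hN : N ∣ Fintype.card K - 1) : ∃ η : Kˣ, orderOf η = N := by
  classical
  obtain ⟨g, hg⟩ := IsCyclic.exists_ofOrder_eq_natCard (α := Kˣ)
  rw [Nat.card_eq_fintype_card, Fintype.card_units] at hg
  obtain ⟨c, hc⟩ := hN
  have hpos : Fintype.card K - 1 ≠ 0 := Nat.sub_ne_zero_of_lt Fintype.one_lt_card
  have hc0 : c ≠ 0 := by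
    rintro rfl
    exact hpos (by simpa using hc)
  refine ⟨g ^ c, ?_⟩
  rw [orderOf_pow_of_dvd hc0 (by rw [hg, hc]; exact dvd_mul_left _ _), hg, hc,
    Nat.mul_div_cancel _ (Nat.pos_of_ne_zero hc0)]

theorem sum_units_pow_pow_eq_zero {K : Type*} [Field K] {η : Kˣ} {N k : ℕ}
    (hη : orderOf η = N) (hk : ¬ N ∣ k) : ∑ i : Fin N, ((η : K) ^ (i : ℕ)) ^ k = 0 := by
  have hne : (η : K) ^ k ≠ 1 := fun h => hk (hη ▸ orderOf_dvd_of_pow_eq_one (Units.ext (by simpa)))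
  have hone : (η : K) ^ N = 1 := by
    rw [← hη, ← Units.val_pow_eq_pow_val, pow_orderOf_eq_one, Units.val_one]
  have h := mul_neg_geom_sum ((η : K) ^ k) N
  rw [← pow_mul, mul_comm k, pow_mul, hone, one_pow, sub_self, mul_eq_zero] at h
  rw [← h.resolve_left (sub_ne_zero.2 hne.symm), ← Fin.sum_univ_eq_sum_range]
  exact Finset.sum_congr rfl fun i _ => pow_right_comm _ _ _

/-- The positions of the blocks: for each element of `A` a block indexed by `Fˣ` and a block indexed
by the disjoint union of `Fˣ` and `Fin v`. -/
abbrev LayoutIndex (A F : Type*) [Field F] (v : ℕ) : Type _ := A × (Fˣ ⊕ (Fˣ ⊕ Fin v))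

section Layout

variable {A F K : Type*} [Field F] [Field K] [Algebra F K] {v : ℕ}

/-- The block of a position. -/
def LayoutIndex.block (p : LayoutIndex A F v) : A × Bool := (p.1, p.2.isRight)

/-- The evaluation point of a position: `Fˣ` in the smaller blocks, `Fˣ ∪ β⟨ζ⟩` in the larger
blocks. -/
def LayoutIndex.point (β : K) (ζ : Fˣ) (p : LayoutIndex A F v) : K :=
  Sum.elim (fun u : Fˣ => algebraMap F K u) (Sum.elim (fun u : Fˣ => algebraMap F K u)
    (fun i : Fin v => β * algebraMap F K ((ζ : F) ^ (i : ℕ)))) p.2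

theorem LayoutIndex.point_ne_zero {β : K} (hβ : β ≠ 0) (ζ : Fˣ) (p : LayoutIndex A F v) :
    p.point β ζ ≠ 0 := by
  obtain ⟨a, u | u | i⟩ := p
  · exact (map_ne_zero _).2 u.ne_zero
  · exact (map_ne_zero _).2 u.ne_zero
  · exact mul_ne_zero hβ ((map_ne_zero _).2 (pow_ne_zero _ ζ.ne_zero))

theorem LayoutIndex.point_injOn {β : K} (hβ : β ∉ Set.range (algebraMap F K)) {ζ : Fˣ}
    (hζ : orderOf ζ = v) {p p' : LayoutIndex A F v} (hb : p.block = p'.block)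
    (h : p.point β ζ = p'.point β ζ) : p = p' := by
  have hmix : ∀ (u : Fˣ) (i : ℕ), algebraMap F K u ≠ β * algebraMap F K ((ζ : F) ^ i) := by
    intro u i hui
    refine hβ ⟨u / (ζ : F) ^ i, ?_⟩
    rw [map_div₀, hui, mul_div_cancel_right₀]
    exact (map_ne_zero _).2 (pow_ne_zero _ ζ.ne_zero)
  have hβ0 : β ≠ 0 := fun h0 => hβ ⟨0, by rw [map_zero, h0]⟩
  obtain ⟨a, u | u | i⟩ := p <;> obtain ⟨a', u' | u' | i'⟩ := p' <;>
    simp only [LayoutIndex.block, LayoutIndex.point, Sum.elim_inl, Sum.elim_inr, Sum.isRight_inl,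
      Sum.isRight_inr, Prod.mk.injEq, and_true, Bool.true_eq_false, Bool.false_eq_true,
      and_false] at hb h
  · rw [hb, Units.ext ((algebraMap F K).injective h)]
  · rw [hb, Units.ext ((algebraMap F K).injective h)]
  · exact absurd h (hmix _ _)
  · exact absurd h.symm (hmix _ _)
  · have h1 := (algebraMap F K).injective (mul_left_cancel₀ hβ0 h)
    have h2 : ζ ^ (i : ℕ) = ζ ^ (i' : ℕ) := Units.ext (by simpa using h1)
    rw [hb, Fin.ext (pow_injOn_Iio_orderOf (by simp [hζ]) (by simp [hζ]) h2)]

variable [Fintype A] [Fintype F] [DecidableEq F]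

theorem LayoutIndex.card_block [DecidableEq A] (b : A × Bool) :
    (Finset.univ.filter fun p : LayoutIndex A F v => p.block = b).card =
      if b.2 then Fintype.card F - 1 + v else Fintype.card F - 1 := by
  rw [Finset.card_filter, Fintype.sum_prod_type]
  obtain ⟨a, c⟩ := b
  rw [Finset.sum_eq_single a]
  · rw [Fintype.sum_sum_type, Fintype.sum_sum_type]
    cases c <;> simp [LayoutIndex.block, Fintype.card_units]
  · intro a' _ ha
    simp [LayoutIndex.block, ha]
  · simp

/-- Frobenius fixes `F`, so the exponent `m + m' * q` acts on the `F`-part of a point as `m + m'`;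
on the coset only a constant power of `β` comes out. -/
theorem LayoutIndex.sum_eq (β : K) (ζ : Fˣ) (w : A × Bool → K) (m m' : ℕ) :
    ∑ p : LayoutIndex A F v,
        w p.block * (p.point β ζ ^ m * (p.point β ζ ^ m') ^ Fintype.card F) =
      ∑ a, (w (a, false) * algebraMap F K (∑ u : Fˣ, (u : F) ^ (m + m')) +
        w (a, true) * (algebraMap F K (∑ u : Fˣ, (u : F) ^ (m + m')) +
          β ^ (m + m' * Fintype.card F) *
            algebraMap F K (∑ i : Fin v, ((ζ : F) ^ (i : ℕ)) ^ (m + m')))) := by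
  have hfrob : ∀ u : F, algebraMap F K u ^ m * (algebraMap F K u ^ m') ^ Fintype.card F
      = algebraMap F K (u ^ (m + m')) := by
    intro u
    rw [← map_pow, ← map_pow, ← map_pow, FiniteField.pow_card, ← map_mul, ← pow_add]
  rw [Fintype.sum_prod_type]
  refine Finset.sum_congr rfl fun a _ => ?_
  rw [Fintype.sum_sum_type, Fintype.sum_sum_type]
  simp only [LayoutIndex.block, LayoutIndex.point, Sum.elim_inl, Sum.elim_inr, Sum.isRight_inl,
      Sum.isRight_inr, hfrob, ← Finset.mul_sum, ← map_sum, ← mul_add]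
  congr 3
  rw [map_sum, Finset.mul_sum]
  refine Finset.sum_congr rfl fun i _ => ?_
  rw [← hfrob]
  ring

theorem LayoutIndex.sum_eq_zero (β : K) {ζ : Fˣ} (hζ : orderOf ζ = v) (w : A × Bool → K)
    {m m' : ℕ} (hpos : 0 < m + m') (hv : m + m' < v) (hq : m + m' < Fintype.card F - 1) :
    ∑ p : LayoutIndex A F v,
        w p.block * (p.point β ζ ^ m * (p.point β ζ ^ m') ^ Fintype.card F) = 0 := by
  rw [LayoutIndex.sum_eq, FiniteField.sum_pow_units,
    if_neg (Nat.not_dvd_of_pos_of_lt hpos hq),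
    sum_units_pow_pow_eq_zero hζ (Nat.not_dvd_of_pos_of_lt hpos hv)]
  simp

/-- Every index `a` carries the same evaluation points, so the weights factor out and no bound on
the exponents is needed. -/
theorem LayoutIndex.sum_eq_zero_of_fst (β : K) (ζ : Fˣ) (w : A → K) (hw : ∑ a, w a = 0)
    (m m' : ℕ) :
    ∑ p : LayoutIndex A F v,
        w p.block.1 * (p.point β ζ ^ m * (p.point β ζ ^ m') ^ Fintype.card F) = 0 := by
  rw [LayoutIndex.sum_eq β ζ (fun b => w b.1)]
  simp only [← mul_add, ← Finset.sum_mul, hw, zero_mul]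

end Layout

/-! ### Arithmetic of the parameters. -/

namespace AdmissibleParams

variable {q N s v t l : ℕ}

theorem three_le_N (h : AdmissibleParams q N s v t l) : 3 ≤ N := by
  obtain ⟨-, hq, hN, hN', -, -, -, -, -, -, -⟩ := h
  by_contra! hlt
  have hpos : 1 < q ^ 2 := Nat.one_lt_pow two_ne_zero (by omega)
  interval_cases N
  · rw [zero_dvd_iff] at hN
    omega
  · exact hN' (one_dvd _)
  · rcases Nat.even_or_odd q with he | ho
    · have h2 : 2 ∣ q ^ 2 := he.two_dvd.trans (dvd_pow_self q two_ne_zero)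
      omega
    · exact hN' (ho.add_odd odd_one).two_dvd

theorem three_mul_v_add_le (h : AdmissibleParams q N s v t l) : 3 * v + s + l + 2 ≤ q + v := by
  have h3 := h.three_le_N
  have hle := h.N_mul_v_mul_t_le
  have h1 : 3 * v ≤ N * v * t := by
    calc 3 * v ≤ N * v := Nat.mul_le_mul_right _ h3
      _ ≤ N * v * t := Nat.le_mul_of_pos_right _ h.t_pos
  omega

end AdmissibleParams

/-- With `r = q + v - s - 1` one has `(n + k) / 2 = 2 * N * t * r - (N * v * t + l)`, and the bound
on `N * v * t` says exactly that the subtracted term is less than `r`. -/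
theorem ceil_rate_eq {q N s v t l : ℕ} (h : AdmissibleParams q N s v t l) {n k : ℕ}
    (hn : n = N * t * (2 * q + v - 2))
    (hk : (k : ℤ) = n - 4 * N * s * t - 2 * l) :
    ⌈((n : ℚ) + k) / (2 * ((q + v - s - 1 : ℕ) : ℚ))⌉ = 2 * N * t := by
  have h3 := h.three_mul_v_add_le
  have hv := h.two_s_add_l_le
  have hq := h.eight_le
  have hle := h.N_mul_v_mul_t_le
  have hkq : (k : ℚ) = n - 4 * N * s * t - 2 * l := by exact_mod_cast hk
  have hr : ((q + v - s - 1 : ℕ) : ℚ) = q + v - s - 1 := by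
    rw [Nat.sub_sub, Nat.cast_sub (by omega)]
    push_cast
    ring
  have hnq : (n : ℚ) = N * t * (2 * q + v - 2) := by
    rw [hn]
    push_cast [Nat.cast_sub (show 2 ≤ 2 * q + v by omega)]
    ring
  have hleq : (N * v * t : ℚ) ≤ q + v - s - l - 2 := by exact_mod_cast hle
  have hrpos : (0 : ℚ) < q + v - s - 1 := by
    rw [← hr]
    exact_mod_cast (by omega : 0 < q + v - s - 1)
  rw [Int.ceil_eq_iff, hkq, hr, hnq]
  push_cast
  constructor
  · rw [lt_div_iff₀ (by positivity)]
    nlinarith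
  · rw [div_le_iff₀ (by positivity)]
    have h1 : (0 : ℚ) ≤ N * v * t := by positivity
    have h2 : (0 : ℚ) ≤ l := by positivity
    nlinarith

theorem infinite_admissible_lengths :
    {n : ℕ | ∃ q N s v t l : ℕ, AdmissibleParams q N s v t l ∧
      n = N * t * (2 * q + v - 2)}.Infinite := by
  -- Powers of `4` are `1` modulo `3`, so `3` divides `q - 1` but not `q + 1`; the shift by `2`
  -- ensures `q ≥ 16`.
  have hadm : ∀ m : ℕ, AdmissibleParams (4 ^ (m + 2)) 3 1 3 1 0 := by
    intro m
    have hmod : 4 ^ (m + 2) % 3 = 1 := by rw [Nat.pow_mod]; simp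
    have hge : 16 ≤ 4 ^ (m + 2) := by
      rw [pow_add]
      exact Nat.le_mul_of_pos_left _ (by positivity)
    have hd : 3 ∣ 4 ^ (m + 2) - 1 := by omega
    refine ⟨?_, by omega, ?_, by omega, one_pos, by omega, one_pos, hd, by omega, by omega, ?_⟩
    · refine IsPrimePow.pow ?_ (by omega)
      exact (isPrimePow_nat_iff 4).2 ⟨2, 2, Nat.prime_two, by omega, by norm_num⟩
    · have hmod2 : (4 ^ (m + 2)) ^ 2 % 3 = 1 := by rw [Nat.pow_mod, hmod]
      omega
    · push_cast
      have : (16 : ℤ) ≤ 4 ^ (m + 2) := by exact_mod_cast hge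
      omega
  refine Set.infinite_of_injective_forall_mem (f := fun m : ℕ => 3 * 1 * (2 * 4 ^ (m + 2) + 3 - 2))
    ?_ fun m => ⟨_, _, _, _, _, _, hadm m, rfl⟩
  intro m m' h
  have : 4 ^ (m + 2) = 4 ^ (m' + 2) := by
    simp only at h
    omega
  simpa using Nat.pow_right_injective (le_refl 2 |>.trans (by norm_num : 2 ≤ 4)) this

/-! ### Assembly of the optimal codes. -/

theorem exists_block_layout {F K : Type*} [Field F] [Fintype F] [Field K] [Fintype K]
    [Algebra F K] {q N s v t l n : ℕ} (h : AdmissibleParams q N s v t l)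
    (hn : n = N * t * (2 * q + v - 2))
    (hF : Fintype.card F = q) (hK : Fintype.card K = q ^ 2) {β : K}
    (hβ : β ∉ Set.range (algebraMap F K)) :
    ∃ (blk : Fin n → (Fin N × Fin t) × Bool)
      (x : Fin n → K) (γ : (Fin N × Fin t) × Bool → K),
      (∀ b, Set.InjOn x (blockPositions blk b)) ∧ (∀ j, x j ≠ 0) ∧ (∀ b, γ b ≠ 0) ∧
      (∀ b, q - 1 ≤ (blockPositions blk b).card) ∧
      (∀ b, (blockPositions blk b).card ≤ q - 1 + v) ∧
      (∀ (w : (Fin N × Fin t) × Bool → K) (m m' : ℕ), 1 ≤ m → 1 ≤ m' → m + m' ≤ 2 * s + l →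
        ∑ j, w (blk j) * (x j ^ m * (x j ^ m') ^ Fintype.card F) = 0) ∧
      (∀ m m' : ℕ, ∑ j, (γ (blk j) * γ (blk j) ^ Fintype.card F) *
        (x j ^ m * (x j ^ m') ^ Fintype.card F) = 0) := by
  classical
  have hβ0 : β ≠ 0 := fun h0 => hβ ⟨0, by rw [map_zero, h0]⟩
  obtain ⟨ζ, hζ⟩ := exists_units_orderOf_eq F (N := v) (by rw [hF]; exact h.v_dvd)
  obtain ⟨η, hη⟩ := exists_units_orderOf_eq K (N := N) (by rw [hK]; exact h.N_dvd)
  have hq := h.eight_le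
  have hsv := h.two_s_add_l_le
  have hv3 := h.three_mul_v_add_le
  have hvpos := h.v_pos
  let e : Fin n ≃ LayoutIndex (Fin N × Fin t) F v :=
    (Fintype.equivFinOfCardEq (by
      simp only [Fintype.card_prod, Fintype.card_sum, Fintype.card_fin, Fintype.card_units, hF, hn]
      congr 1
      omega)).symm
  have hcard : ∀ b, (blockPositions (fun j => (e j).block) b).card =
      if b.2 then q - 1 + v else q - 1 := by
    intro b
    have hb := LayoutIndex.card_block (F := F) (v := v) b
    rw [hF] at hb
    rw [← hb, blockPositions, Finset.card_filter, Finset.card_filter, ← Equiv.sum_comp e]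
  -- The multiplier depends only on the `Fin N` index, so its `(q + 1)`-th powers form a full
  -- geometric sum that vanishes.
  refine ⟨fun j => (e j).block, fun j => (e j).point β ζ, fun b => (η : K) ^ (b.1.1 : ℕ),
    ?_, fun j => LayoutIndex.point_ne_zero hβ0 ζ _, fun b => pow_ne_zero _ η.ne_zero, ?_, ?_, ?_,
    ?_⟩
  · intro b i hi j hj hij
    rw [Finset.mem_coe, mem_blockPositions] at hi hj
    exact e.injective (LayoutIndex.point_injOn hβ hζ (hi.trans hj.symm) hij)
  · intro b
    rw [hcard]
    split_ifs <;> omega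
  · intro b
    rw [hcard]
    split_ifs <;> omega
  · intro w m m' hm hm' hle
    rw [Equiv.sum_comp e (fun p => w p.block *
      (p.point β ζ ^ m * (p.point β ζ ^ m') ^ Fintype.card F))]
    exact LayoutIndex.sum_eq_zero β hζ w (by omega) (by omega) (by omega)
  · intro m m'
    rw [Equiv.sum_comp e (fun p => ((η : K) ^ (p.block.1.1 : ℕ) *
      ((η : K) ^ (p.block.1.1 : ℕ)) ^ Fintype.card F) *
      (p.point β ζ ^ m * (p.point β ζ ^ m') ^ Fintype.card F))]
    refine LayoutIndex.sum_eq_zero_of_fst β ζ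
      (fun a : Fin N × Fin t => (η : K) ^ (a.1 : ℕ) * ((η : K) ^ (a.1 : ℕ)) ^ Fintype.card F) ?_ m m'
    simp only [Fintype.sum_prod_type, Finset.sum_const, ← pow_succ', ← Finset.smul_sum, hF,
      sum_units_pow_pow_eq_zero hη h.N_not_dvd, smul_zero]

theorem notMem_range_of_linearIndependent {F K : Type*} [Field F] [Fintype F] [Field K]
    [Algebra F K] {β : K} (hβ : LinearIndependent F ![β, β ^ Fintype.card F]) :
    β ∉ Set.range (algebraMap F K) := by
  rintro ⟨a, rfl⟩
  rw [algebraMap_pow_card_base, LinearIndependent.pair_iff] at hβ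
  exact one_ne_zero (hβ 1 (-1) (by simp)).1

theorem exists_isOptimalQuantumLRC {F K : Type*} [Field F] [Fintype F] [DecidableEq F] [Field K]
    [Fintype K] [DecidableEq K] [Algebra F K] {q N s v t l n : ℕ}
    (h : AdmissibleParams q N s v t l) (hn : n = N * t * (2 * q + v - 2))
    (hF : Fintype.card F = q) (hK : Fintype.card K = q ^ 2)
    {χ : AddChar F ℂ} (hχ : χ ≠ 1) {β : K} (hβ : LinearIndependent F ![β, β ^ q]) :
    ∃ k : ℕ, (k : ℤ) = N * t * (2 * q + v - 2) - 4 * N * s * t - 2 * l ∧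
      ∃ Q : Submodule ℂ (QuditSpace F n),
        IsOptimalQuantumLRC χ β Q k (s + l + 1) (q + v - s - 1) (s + 1) := by
  have hK' : Fintype.card K = Fintype.card F ^ 2 := by rw [hF, hK]
  rw [← hF] at hβ
  obtain ⟨blk, x, γ, hinj, h0, hγ, hge, hle, hloc, hglob⟩ :=
    exists_block_layout h hn hF hK (notMem_range_of_linearIndependent hβ)
  have hq := h.eight_le
  have hsv := h.two_s_add_l_le
  have hv3 := h.three_mul_v_add_le
  have hl := h.l_le
  have hs := h.s_pos
  have hNpos : 0 < N := lt_of_lt_of_le (by norm_num) h.three_le_N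
  have : Nonempty (Fin N × Fin t) := ⟨⟨0, hNpos⟩, ⟨0, h.t_pos⟩⟩
  have hnZ : (n : ℤ) = N * t * (2 * q + v - 2) := by
    rw [hn]
    push_cast [Nat.cast_sub (show 2 ≤ 2 * q + v by omega)]
    ring
  have hNt : 1 ≤ N * t := Nat.mul_pos hNpos h.t_pos
  have hkle : 4 * N * s * t + 2 * l ≤ n := by
    have h1 : N * t * (4 * s + 2 * l) ≤ n := hn ▸ Nat.mul_le_mul_left _ (by omega)
    have h2 : 2 * l ≤ N * t * (2 * l) := Nat.le_mul_of_pos_left _ hNt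
    calc 4 * N * s * t + 2 * l ≤ 4 * N * s * t + N * t * (2 * l) := by omega
      _ = N * t * (4 * s + 2 * l) := by ring
      _ ≤ n := h1
  obtain ⟨k, hk⟩ := Nat.exists_eq_add_of_le hkle
  have hkZ : (k : ℤ) = n - 4 * N * s * t - 2 * l := by
    rw [hk]
    push_cast
    ring
  refine ⟨k, by rw [hkZ, hnZ], ?_⟩
  set D := checkCode blk x γ s l with hD
  have hDD : hermitianDual (Fintype.card F) (hermitianDual (Fintype.card F) D) = D :=
    hermitianDual_hermitianDual hK' D
  have hDle : D ≤ hermitianDual (Fintype.card F) D := checkCode_le_hermitianDual hK' hloc hglob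
  have hdim : 2 * Module.finrank K (hermitianDual (Fintype.card F) D) = n + k := by
    rw [finrank_hermitianDual hK', hD, finrank_checkCode hinj h0 hγ fun b =>
      le_trans (by omega) (hge b)]
    simp only [Fintype.card_prod, Fintype.card_fin, Fintype.card_bool]
    have : 2 * (N * t * 2 * s + l) = 4 * N * s * t + 2 * l := by ring
    omega
  have hmin : MinDistGE (hermitianDual (Fintype.card F) D) (s + l + 1) :=
    minDistGE_hermitianDual_checkCode hinj h0 hγ (by omega)
  -- This makes the code pure: `D` has no words of minimum weight, so `y` gives an undetected error.
  -- It also yields the required bound on the distance of the dual.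
  have hDmin : MinDistGE D (s + l + 2) := by
    intro c hc hc0
    have := le_hammingNorm_of_mem_checkCode hinj h0 hge hc hc0
    omega
  obtain ⟨y, hy, hy0, hyle⟩ := exists_mem_hermitianDual_checkCode_hammingNorm_le (F := F)
    (blk := blk) (x := x) (γ := γ) (s := s) (l := l)
    (b := Classical.arbitrary _) (le_trans (by omega) (hge _))
  have hynorm : hammingNorm y = s + l + 1 := le_antisymm hyle (hmin y hy hy0)
  have hyD : y ∉ D := fun hyD => by
    have := hDmin y hyD hy0
    omega
  obtain ⟨Q, hQ, hQC⟩ := exists_isQuantumCode_isInducedBy hK' hχ hβ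
    (hermitianDual (Fintype.card F) D) (by rwa [hDD]) hdim
    (fun c hc hcD => hmin c hc fun hc0 => hcD (hc0 ▸ Submodule.zero_mem _))
    ⟨y, hy, by rwa [hDD], hynorm⟩
  refine ⟨Q, by omega, by omega, hQ, hermitianDual (Fintype.card F) D, hQC, by rwa [hDD], hdim,
    ⟨⟨y, hy, hy0, hynorm⟩, ?_⟩,
    isLRC_hermitianDual_checkCode hinj h0 fun b => (hle b).trans (by omega), ?_, ?_⟩
  · rintro _ ⟨c, hc, hc0, rfl⟩
    exact hmin c hc hc0
  · rw [hDD]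
    intro c hc hc0
    have := hDmin c hc hc0
    omega
  · rw [ceil_rate_eq h hn hkZ, hkZ]
    push_cast
    ring

theorem theorem9 :
    (∀ q N s v t l : ℕ, AdmissibleParams q N s v t l →
      ∀ (F K : Type*) [Field F] [Fintype F] [DecidableEq F] [Field K] [Fintype K] [DecidableEq K]
        [Algebra F K], Fintype.card F = q → Fintype.card K = q ^ 2 →
      ∀ χ : AddChar F ℂ, χ ≠ 1 →
      ∀ β : K, LinearIndependent F ![β, β ^ q] →
      ∃ k : ℕ, (k : ℤ) = N * t * (2 * q + v - 2) - 4 * N * s * t - 2 * l ∧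
        ∃ Q : Submodule ℂ (QuditSpace F (N * t * (2 * q + v - 2))),
          IsOptimalQuantumLRC χ β Q k (s + l + 1) (q + v - s - 1) (s + 1)) ∧
    {n : ℕ | ∃ q N s v t l : ℕ, AdmissibleParams q N s v t l ∧
      n = N * t * (2 * q + v - 2)}.Infinite :=
  ⟨fun _ _ _ _ _ _ h _ _ _ _ _ _ _ _ _ hF hK _ hχ _ hβ =>
    exists_isOptimalQuantumLRC h rfl hF hK hχ hβ, infinite_admissible_lengths⟩
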